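/- Let $p_0,p_1,p>0$ and $q_0,q\in\mathbb{R}$, and put $\gamma_0=p_0$, $\gamma_1=p_1$, $\gamma_k=p$ for $k\ge 2$, and $\beta_0=q_0$, $\beta_k=q$ for $k\ge 1$. There is exactly one probability measure $\mu$ on $\mathbb{R}$ with Jacobi coefficients $(\beta_n)$, $(\gamma_n)$; that is, all moments of $\mu$ are finite and the monic polynomials given by $P_0=1$, $P_1(x)=x-\beta_0$, $xP_n(x)=P_{n+1}(x)+\beta_nP_n(x)+\gamma_{n-1}P_{n-1}(x)$ $(n\ge1)$ satisfy $\int P_mP_n\,d\mu=0$ for $m\neq n$ and $\int P_n^2\,d\mu>0$. Let $\sqrt{w^2-4p}$ denote the branch that is holomorphic on $\mathbb{C}\setminus[-2\sqrt p,2\sqrt p]$ and asymptotic to $w$ at infinity. (1) For every $z\in\mathbb{C}\setminus\mathbb{R}$, the Stieltjes transform $G^{(2,asym)}(z)=\int_{\mathbb{R}}\frac{d\mu(x)}{z-x}$ is $$G^{(2,asym)}(z)=\frac{(2p-p_1)z-q(2p-p_1)+p_1\sqrt{(z-q)^2-4p}}{(2p-p_1)(z-q_0)(z-q)-2p_0p+p_1(z-q_0)\sqrt{(z-q)^2-4p}},$$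 where the denominator does not vanish. (2) The absolutely continuous part of $\mu$ with respect to Lebesgue measure has the density $$\rho^{(2,asym)}(x)=\frac{1}{2\pi}\,\frac{p_0p_1\sqrt{4p-(x-q)^2}}{(p-p_1)(x-q_0)^2(x-q)^2+\{p_0(p_1-2p)(x-q)+p_1^2(x-q_0)\}(x-q_0)+p_0^2p}\;I_{(q-2\sqrt p,\;q+2\sqrt p)}(x),$$ where $I_A$ is the indicator function of $A$, and the denominator is positive on $(q-2\sqrt p,q+2\sqrt p)$. -/

import Mathlib

open MeasureTheory Set

/-- The monic polynomials `P₀ = 1`, `P₁ = x - β₀`,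
`x P_{n+1} = P_{n+2} + β_{n+1} P_{n+1} + γ_n P_n`. -/
noncomputable def jacobiPoly (β γ : ℕ → ℝ) : ℕ → Polynomial ℝ
  | 0 => 1
  | 1 => Polynomial.X - Polynomial.C (β 0)
  | n + 2 => (Polynomial.X - Polynomial.C (β (n + 1))) * jacobiPoly β γ (n + 1)
      - Polynomial.C (γ n) * jacobiPoly β γ n

/-- `μ` has Jacobi coefficients `β`, `γ`: all moments of `μ` are finite, and the monic polynomials
of the three-term recurrence with coefficients `β`, `γ` are orthogonal polynomials for `μ`. -/
structure HasJacobiCoefficients (μ : Measure ℝ) (β γ : ℕ → ℝ) : Prop where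
  integrable_pow : ∀ n : ℕ, Integrable (fun x : ℝ => x ^ n) μ
  orthogonal : ∀ m n : ℕ, m ≠ n →
    ∫ x, (jacobiPoly β γ m).eval x * (jacobiPoly β γ n).eval x ∂μ = 0
  norm_pos : ∀ n : ℕ, 0 < ∫ x, (jacobiPoly β γ n).eval x ^ 2 ∂μ

/-- The Stieltjes transform `G_μ(z) = ∫ dμ(x) / (z - x)`. -/
noncomputable def stieltjesTransform (μ : Measure ℝ) (z : ℂ) : ℂ :=
  ∫ x : ℝ, 1 / (z - (x : ℂ)) ∂μ

/-- The branch of `√(w² - 4p)` that is holomorphic off the segment `[-2√p, 2√p]` and asymptotic to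
`w` at infinity, as the product of the principal square roots of `w - 2√p` and `w + 2√p`. It is the
branch for which `(w - √(w² - 4p)) / (2p)` maps the upper half plane into the lower one. -/
noncomputable def sqrtBranch (p : ℝ) (w : ℂ) : ℂ :=
  (w - ((2 * Real.sqrt p : ℝ) : ℂ)) ^ (1 / 2 : ℂ) *
    (w + ((2 * Real.sqrt p : ℝ) : ℂ)) ^ (1 / 2 : ℂ)

/-- The sequence `p₀, p₁, p, p, p, …`. -/
def gammaSeq (p₀ p₁ p : ℝ) : ℕ → ℝ
  | 0 => p₀
  | 1 => p₁
  | _ + 2 => p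

/-- The sequence `q₀, q, q, q, …`. -/
def betaSeq (q₀ q : ℝ) : ℕ → ℝ
  | 0 => q₀
  | _ + 1 => q

/-- Numerator of the explicit Stieltjes transform. -/
noncomputable def asymNum (p₁ p q : ℝ) (z : ℂ) : ℂ :=
  (2 * p - p₁) * z - q * (2 * p - p₁) + p₁ * sqrtBranch p (z - q)

/-- Denominator of the explicit Stieltjes transform. -/
noncomputable def asymDen (p₀ p₁ p q₀ q : ℝ) (z : ℂ) : ℂ :=
  (2 * p - p₁) * (z - q₀) * (z - q) - 2 * p₀ * p + p₁ * (z - q₀) * sqrtBranch p (z - q)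

/-- Denominator of the explicit density. -/
noncomputable def densityDen (p₀ p₁ p q₀ q : ℝ) (x : ℝ) : ℝ :=
  (p - p₁) * (x - q₀) ^ 2 * (x - q) ^ 2
    + (p₀ * (p₁ - 2 * p) * (x - q) + p₁ ^ 2 * (x - q₀)) * (x - q₀) + p₀ ^ 2 * p

/-- The explicit density, supported on `(q - 2√p, q + 2√p)`. -/
noncomputable def asymDensity (p₀ p₁ p q₀ q : ℝ) : ℝ → ℝ :=
  (Ioo (q - 2 * Real.sqrt p) (q + 2 * Real.sqrt p)).indicator fun x =>
    1 / (2 * Real.pi) * (p₀ * p₁ * Real.sqrt (4 * p - (x - q) ^ 2) / densityDen p₀ p₁ p q₀ q x)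

/-! The measure `μ` is the spectral measure at `stdVec 0` of the bounded self-adjoint Jacobi
operator `J` with diagonal `β` and off-diagonal `√γ`. Since `P_n(J) e₀` is a positive multiple of
`e_n`, the `P_n` are orthogonal for `μ`. The `P_n` integrate to `δ_{n0}`, which fixes all moments;
as `μ` has compact support, its moments determine it (`eq_of_integral_eval_eq`).

The Stieltjes transform is the resolvent entry `⟪e₀, (z - J)⁻¹ e₀⟫`. From index 2 on the
coefficients of `J` are constant, so `(z - J)u = e₀` is solved by a geometric tail with ratio `t`,
the root of `√p (t + t⁻¹) = z - q` inside the unit disc (`decayRoot_spec`), and three scalar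
equations remain (`exists_resolvent_vector`). They give `G = K / ((z - q₀)K - p₀)` with `K = z - q -
p₁ t / √p`; a sign argument on imaginary parts shows that the denominator does not vanish.

The density is `-Im G / π` on the real line. The formula for `G` extends continuously to the closed
upper half plane minus the finitely many real zeros of its denominator, a null set, so Stieltjes
inversion (`rnDeriv_eq_of_stieltjesTransform`) applies. -/

/-! ### The shift and the Jacobi operator on `ℓ²`. -/

/-- The Hilbert space `ℓ²(ℕ, ℂ)`. -/
abbrev SqSum : Type := lp (fun _ : ℕ => ℂ) 2

/-- The standard basis of `ℓ²(ℕ, ℂ)`. -/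
noncomputable def stdVec (n : ℕ) : SqSum := lp.single 2 n 1

open scoped ComplexInnerProductSpace

theorem inner_stdVec (m n : ℕ) : ⟪stdVec m, stdVec n⟫ = if m = n then (1 : ℂ) else 0 := by
  rw [stdVec, lp.inner_single_left]
  by_cases h : m = n
  · subst h; simp [stdVec]
  · simp [stdVec, h]

theorem orthonormal_stdVec : Orthonormal ℂ stdVec :=
  orthonormal_iff_ite.2 inner_stdVec

theorem orthogonalFamily_stdVec_succ :
    OrthogonalFamily ℂ (fun _ : ℕ => ℂ) fun n : ℕ =>
      LinearIsometry.toSpanSingleton ℂ SqSum (orthonormal_stdVec.1 (n + 1)) :=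
  (orthonormal_stdVec.comp _ (add_left_injective 1)).orthogonalFamily

/-- The unilateral shift on `ℓ²(ℕ, ℂ)`. -/
noncomputable def unilateralShift : SqSum →L[ℂ] SqSum :=
  orthogonalFamily_stdVec_succ.linearIsometry.toContinuousLinearMap

theorem unilateralShift_stdVec (n : ℕ) : unilateralShift (stdVec n) = stdVec (n + 1) := by
  have := orthogonalFamily_stdVec_succ.linearIsometry_apply_single (i := n) (1 : ℂ)
  simp only [LinearIsometry.toSpanSingleton_apply, one_smul] at this
  exact this

theorem norm_unilateralShift_apply (x : SqSum) : ‖unilateralShift x‖ = ‖x‖ :=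
  orthogonalFamily_stdVec_succ.linearIsometry.norm_map x

theorem adjoint_unilateralShift_apply_self (x : SqSum) : ContinuousLinearMap.adjoint unilateralShift (unilateralShift x) = x := by
  refine ext_inner_left ℂ fun y => ?_
  rw [ContinuousLinearMap.adjoint_inner_right]
  exact orthogonalFamily_stdVec_succ.linearIsometry.inner_map_map y x

theorem adjoint_unilateralShift_stdVec_succ (n : ℕ) : ContinuousLinearMap.adjoint unilateralShift (stdVec (n + 1)) = stdVec n := by
  rw [← unilateralShift_stdVec, adjoint_unilateralShift_apply_self]

theorem adjoint_unilateralShift_stdVec_zero : ContinuousLinearMap.adjoint unilateralShift (stdVec 0) = 0 := by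
  refine ext_inner_right ℂ fun y => ?_
  rw [ContinuousLinearMap.adjoint_inner_left, inner_zero_left]
  have h := (orthogonalFamily_stdVec_succ.hasSum_linearIsometry y).mapL (innerSL ℂ (stdVec 0))
  refine h.unique ?_
  convert hasSum_zero with n
  simp [inner_stdVec]

/-- The vector is `∑ tᵏ e_{k+2}`, obtained by inverting `1 - tS` with `S` the isometric shift. -/
theorem exists_geometric_vector {t : ℂ} (ht : ‖t‖ < 1) :
    ∃ v : SqSum, v = stdVec 2 + t • unilateralShift v := by
  have hn : ‖t • unilateralShift‖ < 1 := by
    rw [norm_smul]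
    have : ‖unilateralShift‖ ≤ 1 := ContinuousLinearMap.opNorm_le_bound _ zero_le_one fun x => by
      rw [norm_unilateralShift_apply, one_mul]
    nlinarith [norm_nonneg t]
  obtain ⟨U, hU⟩ := isUnit_one_sub_of_norm_lt_one hn
  have h1 : (U : SqSum →L[ℂ] SqSum) * (↑U⁻¹ : SqSum →L[ℂ] SqSum) = 1 := U.mul_inv
  refine ⟨(↑U⁻¹ : SqSum →L[ℂ] SqSum) (stdVec 2), ?_⟩
  have h2 := DFunLike.congr_fun h1 (stdVec 2)
  rw [hU] at h2
  exact sub_eq_iff_eq_add.1 h2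

/-- The rank-one operator `x ↦ ⟪u, x⟫ v`. -/
noncomputable def ketBra (v u : SqSum) : SqSum →L[ℂ] SqSum :=
  (innerSL ℂ u).smulRight v

/-- The Jacobi operator with diagonal `b₀, b, b, …` and off-diagonal `a₀, a₁, a, a, …`. -/
noncomputable def jacobiOp (a₀ a₁ a b₀ b : ℝ) : SqSum →L[ℂ] SqSum :=
  (b : ℂ) • 1 + (a : ℂ) • (unilateralShift + ContinuousLinearMap.adjoint unilateralShift) + ((b₀ - b : ℝ) : ℂ) • ketBra (stdVec 0) (stdVec 0)
    + ((a₀ - a : ℝ) : ℂ) • (ketBra (stdVec 0) (stdVec 1) + ketBra (stdVec 1) (stdVec 0))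
    + ((a₁ - a : ℝ) : ℂ) • (ketBra (stdVec 1) (stdVec 2) + ketBra (stdVec 2) (stdVec 1))

section
variable (a₀ a₁ a b₀ b : ℝ)

theorem jacobiOp_apply (x : SqSum) : jacobiOp a₀ a₁ a b₀ b x =
    (b : ℂ) • x + (a : ℂ) • (unilateralShift x + ContinuousLinearMap.adjoint unilateralShift x)
    + ((b₀ - b : ℝ) : ℂ) • ((⟪stdVec 0, x⟫ : ℂ) • stdVec 0)
    + ((a₀ - a : ℝ) : ℂ) • ((⟪stdVec 1, x⟫ : ℂ) • stdVec 0 + (⟪stdVec 0, x⟫ : ℂ) • stdVec 1)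
    + ((a₁ - a : ℝ) : ℂ) • ((⟪stdVec 2, x⟫ : ℂ) • stdVec 1
      + (⟪stdVec 1, x⟫ : ℂ) • stdVec 2) := rfl

theorem isSelfAdjoint_jacobiOp : IsSelfAdjoint (jacobiOp a₀ a₁ a b₀ b) := by
  rw [ContinuousLinearMap.isSelfAdjoint_iff_isSymmetric]
  intro x y
  simp only [ContinuousLinearMap.coe_coe, jacobiOp_apply, inner_add_left, inner_add_right,
    inner_smul_left, inner_smul_right, ContinuousLinearMap.adjoint_inner_left,
    ContinuousLinearMap.adjoint_inner_right, Complex.conj_ofReal, inner_conj_symm]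
  ring

theorem jacobiOp_stdVec_zero : jacobiOp a₀ a₁ a b₀ b (stdVec 0) =
    (b₀ : ℂ) • stdVec 0 + (a₀ : ℂ) • stdVec 1 := by
  rw [jacobiOp_apply, unilateralShift_stdVec, adjoint_unilateralShift_stdVec_zero]
  simp only [inner_stdVec]
  norm_num
  module

theorem jacobiOp_stdVec_one : jacobiOp a₀ a₁ a b₀ b (stdVec 1) =
    (a₀ : ℂ) • stdVec 0 + (b : ℂ) • stdVec 1 + (a₁ : ℂ) • stdVec 2 := by
  rw [jacobiOp_apply, unilateralShift_stdVec, adjoint_unilateralShift_stdVec_succ]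
  simp only [inner_stdVec]
  norm_num
  module

theorem jacobiOp_stdVec_two : jacobiOp a₀ a₁ a b₀ b (stdVec 2) =
    (a₁ : ℂ) • stdVec 1 + (b : ℂ) • stdVec 2 + (a : ℂ) • stdVec 3 := by
  rw [jacobiOp_apply, unilateralShift_stdVec, adjoint_unilateralShift_stdVec_succ]
  simp only [inner_stdVec]
  norm_num
  module

theorem jacobiOp_stdVec_add_three (n : ℕ) : jacobiOp a₀ a₁ a b₀ b (stdVec (n + 3)) =
    (a : ℂ) • stdVec (n + 2) + (b : ℂ) • stdVec (n + 3) + (a : ℂ) • stdVec (n + 4) := by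
  rw [jacobiOp_apply, unilateralShift_stdVec, adjoint_unilateralShift_stdVec_succ]
  simp only [inner_stdVec]
  simp
  module

/-- The geometric vector `∑ tᵏ e_{k+2}` satisfies the constant-coefficient recurrence at every index
above 2, so it fails to be an eigenvector only at `e₁` and `e₂`. At `e₂` the missing left neighbour
costs `a / t`, as `b + a t = z - a / t`. -/
theorem exists_jacobiOp_tail {t z : ℂ} (ht : ‖t‖ < 1) (ht0 : t ≠ 0)
    (hz : z = b + a * (t + t⁻¹)) :
    ∃ v : SqSum, (⟪stdVec 0, v⟫ : ℂ) = 0 ∧ (⟪stdVec 1, v⟫ : ℂ) = 0 ∧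
      jacobiOp a₀ a₁ a b₀ b v = z • v - (a / t) • stdVec 2 + (a₁ : ℂ) • stdVec 1 := by
  obtain ⟨v, hv⟩ := exists_geometric_vector ht
  have h0 : (⟪stdVec 0, v⟫ : ℂ) = 0 := by
    rw [hv, inner_add_right, inner_smul_right, ← ContinuousLinearMap.adjoint_inner_left,
      adjoint_unilateralShift_stdVec_zero, inner_stdVec]
    simp
  have h1 : (⟪stdVec 1, v⟫ : ℂ) = 0 := by
    rw [hv, inner_add_right, inner_smul_right, ← ContinuousLinearMap.adjoint_inner_left,
      adjoint_unilateralShift_stdVec_succ 0, inner_stdVec, h0]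
    simp
  have h2 : (⟪stdVec 2, v⟫ : ℂ) = 1 := by
    rw [hv, inner_add_right, inner_smul_right, ← ContinuousLinearMap.adjoint_inner_left,
      adjoint_unilateralShift_stdVec_succ 1, inner_stdVec, h1]
    simp
  have hS : unilateralShift v = t⁻¹ • (v - stdVec 2) := by
    nth_rewrite 2 [hv]
    rw [add_sub_cancel_left, inv_smul_smul₀ ht0]
  have hA : ContinuousLinearMap.adjoint unilateralShift v = stdVec 1 + t • v := by
    nth_rewrite 1 [hv]
    rw [map_add, map_smul, adjoint_unilateralShift_apply_self,
      adjoint_unilateralShift_stdVec_succ 1]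
  refine ⟨v, h0, h1, ?_⟩
  rw [jacobiOp_apply, h0, h1, h2, hS, hA, hz, div_eq_mul_inv]
  push_cast
  module

end

/-! ### Spectral measures from the Riesz representation theorem. -/

section SpectralMeasure

variable {H : Type*} [NormedAddCommGroup H] [InnerProductSpace ℂ H] [CompleteSpace H]

/-- The positive functional `f ↦ ⟪x, f(T) x⟫` on continuous functions on the spectrum. -/
noncomputable def spectralFunctional {T : H →L[ℂ] H} (hT : IsSelfAdjoint T) (x : H) :
    CompactlySupportedContinuousMap (spectrum ℝ T) ℝ →ₚ[ℝ] ℝ :=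
  PositiveLinearMap.mk₀
    { toFun := fun f => (⟪x, cfcHom hT (f : C(spectrum ℝ T, ℝ)) x⟫ : ℂ).re
      map_add' := fun f g => by
        have : ((f + g : CompactlySupportedContinuousMap (spectrum ℝ T) ℝ) :
          C(spectrum ℝ T, ℝ)) = f + g := rfl
        rw [this, map_add, add_apply, inner_add_right, Complex.add_re]
      map_smul' := fun r f => by
        have : ((r • f : CompactlySupportedContinuousMap (spectrum ℝ T) ℝ) :
          C(spectrum ℝ T, ℝ)) = r • (f : C(spectrum ℝ T, ℝ)) := rfl
        rw [this, map_smul, smul_apply, inner_smul_right_eq_smul, Complex.smul_re]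
        rfl }
    fun f hf => by
      have h : 0 ≤ cfcHom hT (f : C(spectrum ℝ T, ℝ)) := (cfcHom_nonneg_iff hT).2 hf
      exact ((ContinuousLinearMap.nonneg_iff_isPositive _).1 h).re_inner_nonneg_right x

/-- The spectral measure of a bounded self-adjoint operator at a vector. -/
theorem exists_spectralMeasure {T : H →L[ℂ] H} (hT : IsSelfAdjoint T) (x : H) :
    ∃ μ : Measure ℝ, IsFiniteMeasure μ ∧ (∃ R : ℝ, 0 ≤ R ∧ μ (Icc (-R) R)ᶜ = 0) ∧
      ∀ f : ℝ → ℝ, Continuous f → ∫ y, f y ∂μ = (⟪x, cfc f T x⟫ : ℂ).re := by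
  have hcpt : IsCompact (spectrum ℝ T) := ContinuousFunctionalCalculus.isCompact_spectrum T
  have : CompactSpace (spectrum ℝ T) := isCompact_iff_compactSpace.1 hcpt
  -- On the compact spectrum every continuous function has compact support, so the Riesz theorem
  -- covers all of them.
  set m : Measure (spectrum ℝ T) := RealRMK.rieszMeasure (spectralFunctional hT x) with hm
  have hval : Measurable (Subtype.val : spectrum ℝ T → ℝ) := measurable_subtype_coe
  refine ⟨m.map Subtype.val, inferInstance, ?_, fun f hf => ?_⟩
  · obtain ⟨R, hR⟩ := hcpt.isBounded.subset_closedBall 0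
    refine ⟨max R 0, le_max_right _ _, ?_⟩
    rw [Measure.map_apply hval measurableSet_Icc.compl]
    convert measure_empty (μ := m)
    ext y
    have := hR y.2
    simp only [Metric.mem_closedBall, dist_zero_right, Real.norm_eq_abs, abs_le] at this
    simp only [mem_preimage, mem_compl_iff, mem_Icc, mem_empty_iff_false, iff_false, not_not]
    exact ⟨by linarith [le_max_left R 0], this.2.trans (le_max_left _ _)⟩
  · rw [integral_map hval.aemeasurable hf.aestronglyMeasurable]
    have := RealRMK.integral_rieszMeasure (spectralFunctional hT x)
      (CompactlySupportedContinuousMap.continuousMapEquiv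
        ⟨fun y : spectrum ℝ T => f y, hf.comp continuous_subtype_val⟩)
    rw [cfc_apply f T hT hf.continuousOn]
    exact this

end SpectralMeasure

theorem integrable_of_continuous_of_measure_compl_Icc {μ : Measure ℝ} [IsFiniteMeasure μ] {R : ℝ}
    (hR : μ (Icc (-R) R)ᶜ = 0) {f : ℝ → ℝ} (hf : Continuous f) : Integrable f μ := by
  have h : μ.restrict (Icc (-R) R) = μ := Measure.restrict_eq_self_of_ae_mem (by
    rw [ae_iff]; exact hR)
  rw [← h]
  exact hf.continuousOn.integrableOn_compact isCompact_Icc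

/-! ### Orthogonal polynomials and resolvents of a spectral measure. -/

section SelfAdjoint

variable {H : Type*} [NormedAddCommGroup H] [InnerProductSpace ℂ H]

/-- In `(T - β_{n+1}) e_{n+1}` the component along `e_n` is cancelled by the `γ_n P_n` term because
`γ_n = a_n²`; each step contributes one factor `a_k`. -/
theorem aeval_jacobiPoly_apply {T : H →L[ℂ] H} {e : ℕ → H} {β γ a : ℕ → ℝ}
    (h0 : T (e 0) = (β 0 : ℂ) • e 0 + (a 0 : ℂ) • e 1)
    (hs : ∀ n, T (e (n + 1)) =
      (a n : ℂ) • e n + (β (n + 1) : ℂ) • e (n + 1) + (a (n + 1) : ℂ) • e (n + 2))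
    (hγ : ∀ n, γ n = a n ^ 2) (n : ℕ) :
    Polynomial.aeval T (jacobiPoly β γ n) (e 0)
      = ((∏ k ∈ Finset.range n, a k : ℝ) : ℂ) • e n := by
  have hC : ∀ (r : ℝ) (x : H), (algebraMap ℝ (H →L[ℂ] H) r) x = (r : ℂ) • x := fun r x => by
    rw [Algebra.algebraMap_eq_smul_one, smul_apply, one_apply_eq_self]
    exact (Complex.coe_smul r x).symm
  induction n using Nat.twoStepInduction with
  | zero => simp [jacobiPoly]
  | one =>
    simp only [jacobiPoly, map_sub, Polynomial.aeval_X, Polynomial.aeval_C, sub_apply, hC, h0,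
      Finset.prod_range_one]
    module
  | more n ih1 ih2 =>
    simp only [jacobiPoly, map_sub, map_mul, Polynomial.aeval_X, Polynomial.aeval_C, sub_apply,
      mul_apply_eq_comp, hC, ih1, ih2, hs, map_smul, hγ]
    rw [Finset.prod_range_succ _ (n + 1), Finset.prod_range_succ _ n]
    push_cast
    module

variable [CompleteSpace H]

theorem inner_left_eq_of_isSelfAdjoint {T : H →L[ℂ] H} (hT : IsSelfAdjoint T) (x y : H) :
    (⟪T x, y⟫ : ℂ) = ⟪x, T y⟫ :=
  (ContinuousLinearMap.isSelfAdjoint_iff_isSymmetric.1 hT) x y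

theorem ofReal_re_inner_of_isSelfAdjoint {T : H →L[ℂ] H} (hT : IsSelfAdjoint T) (x : H) :
    (((⟪x, T x⟫ : ℂ).re : ℝ) : ℂ) = ⟪x, T x⟫ := by
  rw [← Complex.conj_eq_iff_re, inner_conj_symm, inner_left_eq_of_isSelfAdjoint hT]

theorem measureReal_univ_of_spectralMeasure {T : H →L[ℂ] H} (hT : IsSelfAdjoint T) {x : H}
    {μ : Measure ℝ}
    (hμ : ∀ f : ℝ → ℝ, Continuous f → ∫ y, f y ∂μ = (⟪x, cfc f T x⟫ : ℂ).re) :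
    μ.real univ = ‖x‖ ^ 2 := by
  have h := hμ (fun _ => 1) continuous_const
  rw [cfc_const_one ℝ T hT, one_apply_eq_self, integral_const, smul_eq_mul, mul_one] at h
  rw [h]
  exact inner_self_eq_norm_sq (𝕜 := ℂ) x

/-- Moving the self-adjoint `P_m(T)` across the inner product turns `∫ P_m P_n dμ` into `⟪P_m(T) e₀,
P_n(T) e₀⟫`, and both vectors are multiples of basis vectors. -/
theorem hasJacobiCoefficients_of_spectralMeasure {T : H →L[ℂ] H} (hT : IsSelfAdjoint T)
    {e : ℕ → H} (he : Orthonormal ℂ e) {β γ a : ℕ → ℝ}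
    (h0 : T (e 0) = (β 0 : ℂ) • e 0 + (a 0 : ℂ) • e 1)
    (hs : ∀ n, T (e (n + 1)) =
      (a n : ℂ) • e n + (β (n + 1) : ℂ) • e (n + 1) + (a (n + 1) : ℂ) • e (n + 2))
    (hγ : ∀ n, γ n = a n ^ 2) (ha : ∀ n, 0 < a n) {μ : Measure ℝ}
    (hint : ∀ n : ℕ, Integrable (fun x : ℝ => x ^ n) μ)
    (hμ : ∀ f : ℝ → ℝ, Continuous f → ∫ y, f y ∂μ = (⟪e 0, cfc f T (e 0)⟫ : ℂ).re) :
    HasJacobiCoefficients μ β γ := by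
  have key : ∀ m n, ∫ x, (jacobiPoly β γ m).eval x * (jacobiPoly β γ n).eval x ∂μ
      = (∏ k ∈ Finset.range m, a k) * (∏ k ∈ Finset.range n, a k) * if m = n then 1 else 0 := by
    intro m n
    rw [hμ _ (by fun_prop), cfc_mul _ _ T (Polynomial.continuous _).continuousOn
      (Polynomial.continuous _).continuousOn, mul_apply_eq_comp,
      ← inner_left_eq_of_isSelfAdjoint (cfc_predicate _ _), cfc_polynomial _ T hT,
      cfc_polynomial _ T hT, aeval_jacobiPoly_apply h0 hs hγ, aeval_jacobiPoly_apply h0 hs hγ,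
      inner_smul_left, inner_smul_right, orthonormal_iff_ite.1 he]
    rw [Complex.conj_ofReal]
    generalize ∏ k ∈ Finset.range m, a k = A
    generalize ∏ k ∈ Finset.range n, a k = B
    split_ifs <;> simp
  refine ⟨hint, fun m n hmn => ?_, fun n => ?_⟩
  · rw [key, if_neg hmn, mul_zero]
  · simp only [pow_two]
    rw [key, if_pos rfl, mul_one]
    have := Finset.prod_pos (s := Finset.range n) fun k _ => ha k
    positivity

/-- The available calculus is for real functions, so the kernel is split as `1 / (z - y) = d h - i
(Im z) h` with `d = Re z - y` and `h = 1 / (d² + (Im z)²)`. -/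
theorem stieltjesTransform_of_spectralMeasure {T : H →L[ℂ] H} (hT : IsSelfAdjoint T) {x u : H}
    {μ : Measure ℝ} [IsFiniteMeasure μ]
    (hint : ∀ f : ℝ → ℝ, Continuous f → Integrable f μ)
    (hμ : ∀ f : ℝ → ℝ, Continuous f → ∫ y, f y ∂μ = (⟪x, cfc f T x⟫ : ℂ).re)
    {z : ℂ} (hz : z.im ≠ 0) (hu : z • u - T u = x) :
    stieltjesTransform μ z = ⟪x, u⟫ := by
  have hpos : ∀ y : ℝ, (z.re - y) ^ 2 + z.im ^ 2 ≠ 0 := fun y => by positivity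
  set d : ℝ → ℝ := fun y => z.re - y with hd
  set h : ℝ → ℝ := fun y => ((z.re - y) ^ 2 + z.im ^ 2)⁻¹ with hh
  have hdc : Continuous d := by fun_prop
  have hhc : Continuous h := Continuous.inv₀ (by fun_prop) hpos
  have hkc : Continuous fun y => d y * h y := hdc.mul hhc
  have h1 : ∀ y : ℝ, 1 / (z - (y : ℂ)) = ((d y * h y : ℝ) : ℂ) + ((h y : ℝ) : ℂ) * (-(z.im : ℂ)
      * Complex.I) := by
    intro y
    have hzy : z - y ≠ 0 := fun h0 => hz (by simpa using congrArg Complex.im h0)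
    have hp : (((z.re - y) ^ 2 + z.im ^ 2 : ℝ) : ℂ) ≠ 0 := Complex.ofReal_ne_zero.2 (hpos y)
    rw [div_eq_iff hzy]
    simp only [hd, hh]
    have hzz : z - y = ((z.re - y : ℝ) : ℂ) + z.im * Complex.I := by
      apply Complex.ext <;> simp
    rw [hzz]
    push_cast at hp ⊢
    field_simp
    ring_nf
    rw [Complex.I_sq]
    ring
  have hD : T = (z.re : ℂ) • (1 : H →L[ℂ] H) - cfc d T := by
    have : cfc d T = algebraMap ℝ (H →L[ℂ] H) z.re - T := by
      rw [hd, cfc_sub (fun _ => z.re) (fun y => y) T, cfc_const z.re T hT, cfc_id' ℝ T hT]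
    rw [this, Algebra.algebraMap_eq_smul_one, Complex.coe_smul, sub_sub_cancel]
  have hone : cfc d T * (cfc d T * cfc h T) + ((z.im : ℂ) ^ 2) • cfc h T = 1 := by
    have e1 : ((z.im : ℂ) ^ 2) • cfc h T = cfc (fun y => z.im ^ 2 * h y) T := by
      rw [cfc_const_mul (z.im ^ 2) h T hhc.continuousOn, ← Complex.coe_smul]
      push_cast; rfl
    rw [e1, ← cfc_mul d h T hdc.continuousOn hhc.continuousOn,
      ← cfc_mul d (fun y => d y * h y) T hdc.continuousOn hkc.continuousOn,
      ← cfc_add T (fun y => d y * (d y * h y)) (fun y => z.im ^ 2 * h y)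
        (hdc.mul hkc).continuousOn (continuous_const.mul hhc).continuousOn]
    rw [← cfc_const_one ℝ T]
    congr 1
    ext y
    simp only [hd, hh]
    field_simp [hpos y]
  have hcomm : cfc h T * cfc d T = cfc d T * cfc h T := cfc_commute_cfc h d T
  have hx : x = cfc d T u + ((z.im : ℂ) * Complex.I) • u := by
    rw [← hu]
    nth_rewrite 1 [hD]
    rw [sub_apply, smul_apply, one_apply_eq_self]
    nth_rewrite 1 [← Complex.re_add_im z]
    module
  -- Applying `(d(T) - i Im z) h(T)` to `x = (d(T) + i Im z) u` returns `u`, by `hone`.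
  have hux : u = (cfc d T * cfc h T) x + (-(z.im : ℂ) * Complex.I) • cfc h T x := by
    have h2 := DFunLike.congr_fun hone u
    have h3 := DFunLike.congr_fun hcomm u
    simp only [add_apply, smul_apply, mul_apply_eq_comp, one_apply_eq_self] at h2
    simp only [mul_apply_eq_comp] at h3
    rw [hx]
    simp only [map_add, map_smul, mul_apply_eq_comp, h3]
    nth_rewrite 1 [← h2]
    have hI : ((z.im : ℂ) ^ 2) = (-(z.im : ℂ) * Complex.I) * ((z.im : ℂ) * Complex.I) := by
      ring_nf; rw [Complex.I_sq]; ring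
    rw [hI]
    module
  have hdh : cfc d T * cfc h T = cfc (fun y => d y * h y) T :=
    (cfc_mul d h T hdc.continuousOn hhc.continuousOn).symm
  rw [stieltjesTransform]
  simp_rw [h1]
  rw [integral_add (hint _ hkc).ofReal ((hint _ hhc).ofReal.mul_const _),
    integral_mul_const, integral_complex_ofReal, integral_complex_ofReal, hμ _ hkc,
    hμ _ hhc, ofReal_re_inner_of_isSelfAdjoint (cfc_predicate _ _),
    ofReal_re_inner_of_isSelfAdjoint (cfc_predicate _ _)]
  conv_rhs => rw [hux]
  rw [hdh, inner_add_right, inner_smul_right, mul_comm (inner ℂ x (cfc h T x))]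

end SelfAdjoint

/-! ### Uniqueness of the measure. -/

section Determinacy

theorem monic_and_natDegree_jacobiPoly (β γ : ℕ → ℝ) (n : ℕ) :
    (jacobiPoly β γ n).Monic ∧ (jacobiPoly β γ n).natDegree = n := by
  induction n using Nat.twoStepInduction with
  | zero => simp [jacobiPoly]
  | one => exact ⟨Polynomial.monic_X_sub_C _, Polynomial.natDegree_X_sub_C _⟩
  | more n ih1 ih2 =>
    have hm : ((Polynomial.X - Polynomial.C (β (n + 1))) * jacobiPoly β γ (n + 1)).Monic :=
      (Polynomial.monic_X_sub_C _).mul ih2.1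
    have hd : ((Polynomial.X - Polynomial.C (β (n + 1))) * jacobiPoly β γ (n + 1)).natDegree
        = n + 2 := by
      rw [(Polynomial.monic_X_sub_C _).natDegree_mul ih2.1, ih2.2, Polynomial.natDegree_X_sub_C]
      omega
    have hl : (Polynomial.C (γ n) * jacobiPoly β γ n).natDegree < n + 2 :=
      (Polynomial.natDegree_C_mul_le _ _).trans_lt (by omega)
    have hl' : (Polynomial.C (γ n) * jacobiPoly β γ n).degree <
        ((Polynomial.X - Polynomial.C (β (n + 1))) * jacobiPoly β γ (n + 1)).degree :=
      Polynomial.degree_lt_degree (hd ▸ hl)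
    refine ⟨hm.sub_of_left hl', ?_⟩
    rw [jacobiPoly, Polynomial.natDegree_sub_eq_left_of_natDegree_lt (hd.symm ▸ hl), hd]

theorem integrable_eval_of_integrable_pow {μ : Measure ℝ}
    (h : ∀ n : ℕ, Integrable (fun x : ℝ => x ^ n) μ) (P : Polynomial ℝ) :
    Integrable (fun x => P.eval x) μ := by
  simp only [Polynomial.eval_eq_sum_range]
  exact integrable_finsetSum _ fun i _ => (h i).const_mul _

theorem integral_jacobiPoly_eq {μ : Measure ℝ} [IsProbabilityMeasure μ] {β γ : ℕ → ℝ}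
    (h : HasJacobiCoefficients μ β γ) (n : ℕ) :
    ∫ x, (jacobiPoly β γ n).eval x ∂μ = if n = 0 then 1 else 0 := by
  split_ifs with hn
  · subst hn; simp [jacobiPoly]
  · simpa [jacobiPoly] using h.orthogonal n 0 hn

/-- Subtracting the leading coefficient times the monic `P_n` lowers the degree, so the values `∫
P_n = δ_{n0}` determine the integral of every polynomial. -/
theorem integral_eval_eq_of_hasJacobiCoefficients {μ ν : Measure ℝ} [IsProbabilityMeasure μ]
    [IsProbabilityMeasure ν] {β γ : ℕ → ℝ} (hμ : HasJacobiCoefficients μ β γ)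
    (hν : HasJacobiCoefficients ν β γ) (P : Polynomial ℝ) :
    ∫ x, P.eval x ∂μ = ∫ x, P.eval x ∂ν := by
  have key : ∀ n, ∀ P : Polynomial ℝ, P.natDegree < n →
      ∫ x, P.eval x ∂μ = ∫ x, P.eval x ∂ν := by
    intro n
    induction n with
    | zero => intro P hP; exact absurd hP (Nat.not_lt_zero _)
    | succ n ih =>
      intro P hP
      set Q := jacobiPoly β γ P.natDegree with hQ
      obtain ⟨hQm, hQd⟩ := monic_and_natDegree_jacobiPoly β γ P.natDegree
      set R := P - Polynomial.C P.leadingCoeff * Q with hR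
      have hRint : ∫ x, R.eval x ∂μ = ∫ x, R.eval x ∂ν := by
        -- In degree zero the remainder has no smaller `natDegree`, but it is zero.
        by_cases hP0 : P.natDegree = 0
        · have hR0 : R = 0 := by
            rw [hR, hQ, hP0, jacobiPoly, mul_one, Polynomial.leadingCoeff, hP0,
              ← Polynomial.eq_C_of_natDegree_eq_zero hP0, sub_self]
          simp [hR0]
        · refine ih R ?_
          have hle : R.natDegree ≤ P.natDegree - 1 := by
            refine Polynomial.natDegree_le_pred ((Polynomial.natDegree_sub_le_of_le le_rfl
              ((Polynomial.natDegree_C_mul_le _ _).trans hQd.le)).trans (max_self _).le) ?_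
            rw [hR, Polynomial.coeff_sub, Polynomial.coeff_C_mul]
            have : Q.coeff P.natDegree = 1 := by
              have := hQm.coeff_natDegree
              rwa [hQd] at this
            rw [this, mul_one, Polynomial.coeff_natDegree, sub_self]
          omega
      have hPe : ∀ x, P.eval x = R.eval x + P.leadingCoeff * Q.eval x := fun x => by
        simp [hR]
      simp only [hPe]
      rw [integral_add (integrable_eval_of_integrable_pow hμ.integrable_pow _)
          ((integrable_eval_of_integrable_pow hμ.integrable_pow _).const_mul _),
        integral_add (integrable_eval_of_integrable_pow hν.integrable_pow _)
          ((integrable_eval_of_integrable_pow hν.integrable_pow _).const_mul _),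
        integral_const_mul, integral_const_mul, hRint, integral_jacobiPoly_eq hμ,
        integral_jacobiPoly_eq hν]
  exact key _ P (Nat.lt_succ_self _)

/-- For `r > R`, Markov's inequality for `x^(2n)` bounds the mass of `|x| ≥ r` by `(R / r)^(2n)`,
which tends to 0. -/
theorem measure_compl_Icc_eq_zero_of_moments {ν : Measure ℝ} [IsFiniteMeasure ν] {R : ℝ}
    (hR : 0 ≤ R) (hint : ∀ n : ℕ, Integrable (fun x : ℝ => x ^ n) ν)
    (hmom : ∀ n : ℕ, ∫ x, x ^ (2 * n) ∂ν ≤ R ^ (2 * n)) :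
    ν (Icc (-R) R)ᶜ = 0 := by
  have hpiece : ∀ r : ℝ, R < r → ν {x | r ≤ |x|} = 0 := by
    intro r hr
    have hr0 : 0 < r := hR.trans_lt hr
    have hb : ∀ n : ℕ, ν.real {x | r ≤ |x|} ≤ ((R / r) ^ 2) ^ n := by
      intro n
      have h1 := mul_meas_ge_le_integral_of_nonneg (μ := ν) (f := fun x : ℝ => x ^ (2 * n))
        (Filter.Eventually.of_forall fun x => (even_two_mul n).pow_nonneg x) (hint _)
        (r ^ (2 * n))
      have h2 : ν.real {x | r ≤ |x|} ≤ ν.real {x : ℝ | r ^ (2 * n) ≤ x ^ (2 * n)} := by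
        refine measureReal_mono fun x hx => ?_
        simp only [mem_ofPred_eq] at hx ⊢
        rw [← (even_two_mul n).pow_abs x]
        exact pow_le_pow_left₀ hr0.le hx _
      have h3 : r ^ (2 * n) * ν.real {x | r ≤ |x|} ≤ R ^ (2 * n) :=
        ((mul_le_mul_of_nonneg_left h2 (by positivity)).trans h1).trans (hmom n)
      rw [← pow_mul, div_pow, le_div_iff₀ (by positivity)]
      linarith
    have hlt : (R / r) ^ 2 < 1 := by
      have : R / r < 1 := (div_lt_one hr0).2 hr
      have : 0 ≤ R / r := by positivity
      nlinarith
    have hlim := tendsto_pow_atTop_nhds_zero_of_lt_one (sq_nonneg (R / r)) hlt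
    have h0 : ν.real {x | r ≤ |x|} ≤ 0 := ge_of_tendsto' hlim hb
    exact (measureReal_eq_zero_iff).1 (le_antisymm h0 measureReal_nonneg)
  have hU : (Icc (-R) R)ᶜ ⊆ ⋃ n : ℕ, {x : ℝ | R + 1 / (n + 1 : ℝ) ≤ |x|} := by
    intro x hx
    have hx' : R < |x| := by
      by_contra hcon
      exact hx (abs_le.1 (not_lt.1 hcon))
    obtain ⟨n, hn⟩ := exists_nat_one_div_lt (sub_pos.2 hx')
    refine mem_iUnion.2 ⟨n, ?_⟩
    simp only [mem_ofPred_eq]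
    linarith
  refine measure_mono_null hU (measure_iUnion_null fun n => hpiece _ ?_)
  have : (0 : ℝ) < 1 / ((n : ℝ) + 1) := by positivity
  linarith

/-- Compact support is needed for `μ` only: the shared even moments force it on `ν`. Weierstrass
approximation on the interval then finishes. -/
theorem eq_of_integral_eval_eq {μ ν : Measure ℝ} [IsProbabilityMeasure μ]
    [IsProbabilityMeasure ν] {R : ℝ} (hR : 0 ≤ R) (hμ : μ (Icc (-R) R)ᶜ = 0)
    (hν : ∀ n : ℕ, Integrable (fun x : ℝ => x ^ n) ν)
    (h : ∀ P : Polynomial ℝ, ∫ x, P.eval x ∂ν = ∫ x, P.eval x ∂μ) : ν = μ := by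
  have hcμ : ∀ f : ℝ → ℝ, Continuous f → Integrable f μ := fun f hf =>
    integrable_of_continuous_of_measure_compl_Icc hμ hf
  have hν0 : ν (Icc (-R) R)ᶜ = 0 := by
    refine measure_compl_Icc_eq_zero_of_moments hR hν fun n => ?_
    have := h (Polynomial.X ^ (2 * n))
    simp only [Polynomial.eval_pow, Polynomial.eval_X] at this
    rw [this]
    calc ∫ x, x ^ (2 * n) ∂μ ≤ ∫ _, R ^ (2 * n) ∂μ := by
          refine integral_mono_ae (hcμ _ (by fun_prop)) (integrable_const _) ?_
          filter_upwards [show ∀ᵐ x ∂μ, x ∈ Icc (-R) R from ae_iff.2 hμ] with x hx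
          rw [← (even_two_mul n).pow_abs x]
          exact pow_le_pow_left₀ (abs_nonneg x) (abs_le.2 hx) _
      _ = R ^ (2 * n) := by simp
  have hcν : ∀ f : ℝ → ℝ, Continuous f → Integrable f ν := fun f hf =>
    integrable_of_continuous_of_measure_compl_Icc hν0 hf
  refine ext_of_forall_integral_eq_of_IsFiniteMeasure fun f => ?_
  refine eq_of_forall_dist_le fun ε hε => ?_
  obtain ⟨P, hP⟩ := exists_polynomial_near_of_continuousOn (-R) R f f.continuous.continuousOn
    (ε / 2) (half_pos hε)
  have aux : ∀ m : Measure ℝ, IsProbabilityMeasure m → m (Icc (-R) R)ᶜ = 0 →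
      (∀ g : ℝ → ℝ, Continuous g → Integrable g m) →
      |∫ x, P.eval x ∂m - ∫ x, f x ∂m| ≤ ε / 2 := by
    intro m hm hm0 hc
    rw [← integral_sub (hc _ P.continuous) (hc _ f.continuous), ← Real.norm_eq_abs]
    have hb := norm_integral_le_of_norm_le_const (μ := m) (f := fun x => P.eval x - f x)
      (C := ε / 2) (by
        filter_upwards [show ∀ᵐ x ∂m, x ∈ Icc (-R) R from ae_iff.2 hm0] with x hx
        exact (hP x hx).le)
    simpa using hb
  have h1 := aux μ inferInstance hμ hcμ
  have h2 := aux ν inferInstance hν0 hcν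
  rw [h P] at h2
  rw [Real.dist_eq]
  rw [abs_le] at *
  constructor <;> linarith

end Determinacy

/-! ### The square root branch, the decaying root, the nonvanishing denominator. -/

section SqrtBranch

theorem cpow_half_sq (z : ℂ) : (z ^ (1 / 2 : ℂ)) ^ 2 = z := by
  rw [one_div]
  exact Complex.cpow_ofNat_inv_pow z 2

theorem cpow_half_eq_of_im_nonneg {z : ℂ} (hz : 0 ≤ z.im) :
    z ^ (1 / 2 : ℂ) = (√((‖z‖ + z.re) / 2) : ℝ) + (√((‖z‖ - z.re) / 2) : ℝ) * Complex.I := by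
  rw [one_div]
  have := Complex.sqrt_eq_real_add_ite (a := z)
  rwa [if_pos hz, one_mul, Complex.sqrt] at this

theorem cpow_half_re_pos {z : ℂ} (hz : z.im ≠ 0) : 0 < (z ^ (1 / 2 : ℂ)).re := by
  have h0 : 0 ≤ (z ^ (1 / 2 : ℂ)).re := by
    rw [one_div, Complex.cpow_inv_two_re]
    positivity
  refine lt_of_le_of_ne h0 fun h => hz ?_
  have := congrArg Complex.im (cpow_half_sq z)
  rw [pow_two, Complex.mul_im, ← h] at this
  linarith

/-- The principal root jumps across the negative axis, but its values there are the limits from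
above. -/
theorem continuousOn_cpow_half : ContinuousOn (fun z : ℂ => z ^ (1 / 2 : ℂ)) {z | 0 ≤ z.im} := by
  refine ContinuousOn.congr (f := fun z : ℂ => ((√((‖z‖ + z.re) / 2) : ℝ) : ℂ)
    + (√((‖z‖ - z.re) / 2) : ℝ) * Complex.I) ?_ fun z hz => cpow_half_eq_of_im_nonneg hz
  fun_prop

theorem cpow_half_ofReal_of_nonneg {x : ℝ} (hx : 0 ≤ x) : (x : ℂ) ^ (1 / 2 : ℂ) = (√x : ℝ) := by
  rw [cpow_half_eq_of_im_nonneg (by simp)]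
  simp [abs_of_nonneg hx]

theorem cpow_half_ofReal_of_nonpos {x : ℝ} (hx : x ≤ 0) :
    (x : ℂ) ^ (1 / 2 : ℂ) = (√(-x) : ℝ) * Complex.I := by
  rw [cpow_half_eq_of_im_nonneg (by simp)]
  have : (-x - x) / 2 = -x := by ring
  simp [abs_of_nonpos hx, this]

theorem sqrtBranch_sq {p : ℝ} (hp : 0 ≤ p) (w : ℂ) : sqrtBranch p w ^ 2 = w ^ 2 - 4 * p := by
  rw [sqrtBranch, mul_pow, cpow_half_sq, cpow_half_sq]
  have : ((√p : ℝ) : ℂ) ^ 2 = p := by rw [← Complex.ofReal_pow, Real.sq_sqrt hp]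
  push_cast
  linear_combination (-4) * this

theorem continuousOn_sqrtBranch (p : ℝ) : ContinuousOn (sqrtBranch p) {w | 0 ≤ w.im} := by
  refine ContinuousOn.mul ?_ ?_
  · refine continuousOn_cpow_half.comp (by fun_prop) fun w hw => ?_
    simpa using hw
  · refine continuousOn_cpow_half.comp (by fun_prop) fun w hw => ?_
    simpa using hw

theorem sqrtBranch_ofReal_of_sq_lt {p x : ℝ} (hp : 0 ≤ p) (hx : x ^ 2 < 4 * p) :
    sqrtBranch p x = (√(4 * p - x ^ 2) : ℝ) * Complex.I := by
  have h4 : (2 * √p) ^ 2 = 4 * p := by rw [mul_pow, Real.sq_sqrt hp]; norm_num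
  have habs := abs_lt_of_sq_lt_sq (h4.symm ▸ hx) (by positivity)
  rw [abs_lt] at habs
  have h1 : x - 2 * √p ≤ 0 := by linarith
  have h2 : 0 ≤ x + 2 * √p := by linarith
  rw [sqrtBranch, ← Complex.ofReal_sub, ← Complex.ofReal_add, cpow_half_ofReal_of_nonpos h1,
    cpow_half_ofReal_of_nonneg h2]
  have : 4 * p - x ^ 2 = -(x - 2 * √p) * (x + 2 * √p) := by rw [← h4]; ring
  rw [this, Real.sqrt_mul (by linarith)]
  push_cast
  ring

theorem sqrtBranch_ofReal_im_of_le_sq {p x : ℝ} (hp : 0 ≤ p) (hx : 4 * p ≤ x ^ 2) :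
    (sqrtBranch p x).im = 0 := by
  have h4 : (2 * √p) ^ 2 = 4 * p := by rw [mul_pow, Real.sq_sqrt hp]; norm_num
  have habs : 2 * √p ≤ |x| := by
    have := sq_le_sq.1 (h4.symm ▸ hx)
    rwa [abs_of_nonneg (by positivity)] at this
  have hs : 0 ≤ √p := Real.sqrt_nonneg p
  rw [sqrtBranch, ← Complex.ofReal_sub, ← Complex.ofReal_add]
  rcases le_abs.1 habs with h | h
  · rw [cpow_half_ofReal_of_nonneg (by linarith), cpow_half_ofReal_of_nonneg (by linarith)]
    simp
  · rw [cpow_half_ofReal_of_nonpos (by linarith), cpow_half_ofReal_of_nonpos (by linarith)]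
    simp

/-- The decaying root of the characteristic equation `√p (t + t⁻¹) = w`. -/
noncomputable def decayRoot (p : ℝ) (w : ℂ) : ℂ := (w - sqrtBranch p w) / (2 * (√p : ℝ))

/-- The two roots have product 1; the branch decides which is small. With `W = AB`, the principal
roots `A`, `B` have positive real parts and imaginary parts of the same sign, so `|A - B| < |A +
B|`, while `w ∓ W = (A ∓ B)² / 2`. The sign claim follows from `Im w = √p Im t (1 - |t|⁻²)`. -/
theorem decayRoot_spec {p : ℝ} (hp : 0 < p) {w : ℂ} (hw : w.im ≠ 0) :
    decayRoot p w ≠ 0 ∧ ‖decayRoot p w‖ < 1 ∧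
      w = (√p : ℝ) * (decayRoot p w + (decayRoot p w)⁻¹) ∧ (decayRoot p w).im * w.im ≤ 0 := by
  have hs : 0 < √p := Real.sqrt_pos.2 hp
  have hsC : ((√p : ℝ) : ℂ) ≠ 0 := Complex.ofReal_ne_zero.2 hs.ne'
  have hss : ((√p : ℝ) : ℂ) ^ 2 = p := by rw [← Complex.ofReal_pow, Real.sq_sqrt hp.le]
  set W := sqrtBranch p w with hW
  have hsq : W ^ 2 = w ^ 2 - 4 * p := sqrtBranch_sq hp.le w
  set t := decayRoot p w with ht
  set t' := (w + W) / (2 * (√p : ℝ)) with ht'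
  have htt : t * t' = 1 := by
    rw [ht, ht', decayRoot, ← hW]
    field_simp
    rw [hss]
    linear_combination -hsq
  have hsum : w = (√p : ℝ) * (t + t') := by
    rw [ht, ht', decayRoot, ← hW]
    field_simp
    ring
  have ht0 : t ≠ 0 := left_ne_zero_of_mul_eq_one htt
  have hinv : t' = t⁻¹ := eq_inv_of_mul_eq_one_right htt
  have hnorm : ‖w - W‖ < ‖w + W‖ := by
    set A := (w - ((2 * √p : ℝ) : ℂ)) ^ (1 / 2 : ℂ) with hA
    set B := (w + ((2 * √p : ℝ) : ℂ)) ^ (1 / 2 : ℂ) with hB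
    have hWAB : W = A * B := rfl
    have hA2 : A ^ 2 = w - ((2 * √p : ℝ) : ℂ) := cpow_half_sq _
    have hB2 : B ^ 2 = w + ((2 * √p : ℝ) : ℂ) := cpow_half_sq _
    have hAr : 0 < A.re := cpow_half_re_pos (by simpa using hw)
    have hBr : 0 < B.re := cpow_half_re_pos (by simpa using hw)
    have hAi : 2 * (A.re * A.im) = w.im := by
      have := congrArg Complex.im hA2
      rw [pow_two, Complex.mul_im] at this
      simp at this
      linarith
    have hBi : 2 * (B.re * B.im) = w.im := by
      have := congrArg Complex.im hB2
      rw [pow_two, Complex.mul_im] at this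
      simp at this
      linarith
    have him : 0 < A.im * B.im := by
      have h1 : 0 < w.im * w.im := mul_self_pos.2 hw
      have h2 : w.im * w.im = (4 * (A.re * B.re)) * (A.im * B.im) := by
        nth_rewrite 1 [← hAi]
        rw [← hBi]
        ring
      rw [h2] at h1
      exact pos_of_mul_pos_right h1 (by positivity)
    have hlt : ‖A - B‖ < ‖A + B‖ := by
      refine lt_of_pow_lt_pow_left₀ 2 (norm_nonneg _) ?_
      rw [Complex.sq_norm, Complex.sq_norm, Complex.normSq_apply, Complex.normSq_apply]
      simp only [Complex.sub_re, Complex.sub_im, Complex.add_re, Complex.add_im]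
      nlinarith [mul_pos hAr hBr]
    have e1 : w - W = (A - B) ^ 2 / 2 := by
      rw [hWAB]; linear_combination (-1 / 2) * hA2 + (-1 / 2) * hB2
    have e2 : w + W = (A + B) ^ 2 / 2 := by
      rw [hWAB]; linear_combination (-1 / 2) * hA2 + (-1 / 2) * hB2
    rw [e1, e2, norm_div, norm_div, norm_pow, norm_pow]
    gcongr
    norm_num
  have hlt' : ‖t‖ < ‖t'‖ := by
    rw [ht, ht', decayRoot, ← hW, norm_div, norm_div]
    have : 0 < ‖(2 * (√p : ℝ) : ℂ)‖ := norm_pos_iff.2 (mul_ne_zero two_ne_zero hsC)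
    gcongr
  have ht1 : ‖t‖ < 1 := by
    have h1 : ‖t‖ * ‖t'‖ = 1 := by rw [← norm_mul, htt, norm_one]
    nlinarith [norm_nonneg t]
  refine ⟨ht0, ht1, hinv ▸ hsum, ?_⟩
  have hN : 0 < Complex.normSq t := Complex.normSq_pos.2 ht0
  have hN1 : Complex.normSq t < 1 := by
    rw [← Complex.sq_norm]; nlinarith [norm_nonneg t]
  have him : w.im = √p * (t.im - t.im / Complex.normSq t) := by
    have := congrArg Complex.im hsum
    rw [hinv, Complex.im_ofReal_mul, Complex.add_im, Complex.inv_im] at this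
    rw [this]; ring
  have : t.im * w.im = -(√p * t.im ^ 2 * (1 - Complex.normSq t) / Complex.normSq t) := by
    rw [him]
    field_simp
    ring
  rw [this]
  have : 0 ≤ 1 - Complex.normSq t := by linarith
  have := hs.le
  have : 0 ≤ √p * t.im ^ 2 * (1 - Complex.normSq t) / Complex.normSq t := by positivity
  linarith

theorem asymNum_eq {p₁ p q : ℝ} (hp : 0 < p) (z : ℂ) :
    asymNum p₁ p q z = 2 * p * (z - q - p₁ * (decayRoot p (z - q) / (√p : ℝ))) := by
  have hsC : ((√p : ℝ) : ℂ) ≠ 0 := Complex.ofReal_ne_zero.2 (Real.sqrt_pos.2 hp).ne'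
  have hss : (p : ℂ) = ((√p : ℝ) : ℂ) ^ 2 := by rw [← Complex.ofReal_pow, Real.sq_sqrt hp.le]
  rw [asymNum, decayRoot, hss]
  field_simp
  ring

theorem asymDen_eq (p₀ p₁ p q₀ q : ℝ) (z : ℂ) :
    asymDen p₀ p₁ p q₀ q z = (z - q₀) * asymNum p₁ p q z - 2 * p₀ * p := by
  rw [asymDen, asymNum]
  ring

/-- A zero would give `z - q₀ = p₀ / K`, but inversion flips the sign of the imaginary part. -/
theorem sub_mul_sub_ne_zero {p₀ q₀ : ℝ} (hp₀ : 0 < p₀) {z K : ℂ} (hK : 0 < K.im * z.im) :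
    (z - q₀) * K - p₀ ≠ 0 := by
  intro h
  have h1 : (z - q₀) * Complex.normSq K = p₀ * (starRingEnd ℂ) K := by
    rw [← Complex.mul_conj]
    linear_combination (starRingEnd ℂ K) * h
  have h2 := congrArg Complex.im h1
  rw [Complex.im_mul_ofReal, Complex.im_ofReal_mul, Complex.conj_im, Complex.sub_im,
    Complex.ofReal_im, sub_zero] at h2
  have h3 : z.im * z.im * Complex.normSq K = -(p₀ * (K.im * z.im)) := by
    linear_combination z.im * h2
  have h4 : 0 ≤ z.im * z.im * Complex.normSq K :=
    mul_nonneg (mul_self_nonneg _) (Complex.normSq_nonneg _)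
  nlinarith [mul_pos hp₀ hK]

theorem asymDen_ne_zero {p₀ p₁ p : ℝ} (q₀ q : ℝ) (hp₀ : 0 < p₀) (hp₁ : 0 < p₁) (hp : 0 < p)
    {z : ℂ} (hz : z.im ≠ 0) : asymDen p₀ p₁ p q₀ q z ≠ 0 := by
  have hw : (z - q).im ≠ 0 := by simpa using hz
  obtain ⟨-, -, -, h⟩ := decayRoot_spec hp hw
  have hs : 0 < √p := Real.sqrt_pos.2 hp
  rw [asymDen_eq, asymNum_eq hp]
  set t := decayRoot p (z - q)
  have hK : 0 < (z - q - p₁ * (t / (√p : ℝ))).im * z.im := by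
    rw [Complex.sub_im, Complex.im_ofReal_mul, Complex.div_ofReal_im]
    simp only [Complex.sub_im, Complex.ofReal_im, sub_zero] at h ⊢
    have h1 : 0 < z.im * z.im := mul_self_pos.2 hz
    have h2 : p₁ / √p * (t.im * z.im) ≤ 0 :=
      mul_nonpos_of_nonneg_of_nonpos (by positivity) h
    have : (z.im - p₁ * (t.im / √p)) * z.im = z.im * z.im - p₁ / √p * (t.im * z.im) := by ring
    rw [this]; linarith
  have := sub_mul_sub_ne_zero (q₀ := q₀) hp₀ hK
  intro h0
  refine this ?_
  have hpC : (2 * p : ℂ) ≠ 0 := mul_ne_zero two_ne_zero (Complex.ofReal_ne_zero.2 hp.ne')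
  refine (mul_eq_zero.1 (?_ : (2 * p : ℂ) * _ = 0)).resolve_left hpC
  rw [← h0]; ring

end SqrtBranch

open scoped Topology

/-! ### Stieltjes inversion up to a null set. -/

section StieltjesInversion

theorem neg_im_one_div_sub (x t ε : ℝ) :
    -((1 / ((x : ℂ) + ε * Complex.I - t)).im) = ε / ((x - t) ^ 2 + ε ^ 2) := by
  rw [one_div, Complex.inv_im, Complex.normSq_apply]
  simp
  ring

theorem norm_one_div_sub_le {z : ℂ} (hz : 0 < z.im) (t : ℝ) : ‖1 / (z - (t : ℂ))‖ ≤ 1 / z.im := by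
  rw [norm_div, norm_one]
  gcongr
  have := Complex.abs_im_le_norm (z - t)
  simp only [Complex.sub_im, Complex.ofReal_im, sub_zero] at this
  exact (le_abs_self _).trans this

theorem integrable_one_div_sub (μ : Measure ℝ) [IsFiniteMeasure μ] {z : ℂ} (hz : 0 < z.im) :
    Integrable (fun t : ℝ => 1 / (z - (t : ℂ))) μ := by
  refine Integrable.of_bound (C := 1 / z.im) ?_ (Filter.Eventually.of_forall
    (norm_one_div_sub_le hz))
  exact (by fun_prop : Measurable fun t : ℝ => 1 / (z - (t : ℂ))).aestronglyMeasurable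

theorem neg_im_stieltjesTransform (μ : Measure ℝ) [IsFiniteMeasure μ] (x : ℝ) {ε : ℝ}
    (hε : 0 < ε) : -(stieltjesTransform μ ((x : ℂ) + ε * Complex.I)).im
      = ∫ t, ε / ((x - t) ^ 2 + ε ^ 2) ∂μ := by
  have hz : 0 < ((x : ℂ) + ε * Complex.I).im := by simpa using hε
  simp_rw [← neg_im_one_div_sub, integral_neg]
  congr 1
  exact (integral_im (𝕜 := ℂ) (integrable_one_div_sub μ hz)).symm

theorem integral_mul_poisson_eq (η : ℝ → ℝ) (t : ℝ) {ε : ℝ} (hε : 0 < ε) :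
    ∫ x, η x * (ε / ((x - t) ^ 2 + ε ^ 2)) = ∫ s, η (t + ε * s) * (1 + s ^ 2)⁻¹ := by
  have h1 := integral_add_left_eq_self (μ := volume)
    (fun x => η x * (ε / ((x - t) ^ 2 + ε ^ 2))) t
  have h2 := Measure.integral_comp_mul_left
    (fun y => η (t + y) * (ε / ((t + y - t) ^ 2 + ε ^ 2))) ε
  rw [← h1]
  rw [abs_of_pos (inv_pos.2 hε), smul_eq_mul] at h2
  rw [← mul_right_inj' (inv_ne_zero hε.ne'), ← h2, ← integral_const_mul]
  congr 1
  ext s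
  have : (0 : ℝ) < 1 + s ^ 2 := by positivity
  have h3 : (t + ε * s - t) ^ 2 + ε ^ 2 = ε ^ 2 * (1 + s ^ 2) := by ring
  rw [h3]
  field_simp

/-- Fubini and the substitution `x = t + ε s` move `ε` into the argument of `η`, leaving an
integrable majorant `C / (1 + s²)` independent of `ε`. -/
theorem integral_integral_poisson_eq (μ : Measure ℝ) [IsFiniteMeasure μ] {η : ℝ → ℝ}
    (hη : Continuous η) (hs : HasCompactSupport η) {ε : ℝ} (hε : 0 < ε) :
    ∫ x, η x * ∫ t, ε / ((x - t) ^ 2 + ε ^ 2) ∂μ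
      = ∫ y : ℝ × ℝ, η (y.2 + ε * y.1) * (1 + y.1 ^ 2)⁻¹ ∂(volume.prod μ) := by
  obtain ⟨C, hC⟩ := hη.bounded_above_of_compact_support hs
  have hI1 : Integrable (fun y : ℝ × ℝ => η y.1 * (ε / ((y.1 - y.2) ^ 2 + ε ^ 2)))
      (volume.prod μ) := by
    have hb : Integrable (fun y : ℝ × ℝ => ‖η y.1‖ * (1 / ε)) (volume.prod μ) :=
      Integrable.mul_prod (f := fun x => ‖η x‖) (g := fun _ => 1 / ε)
        (hη.integrable_of_hasCompactSupport hs).norm (integrable_const _)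
    refine hb.mono' ?_ (Filter.Eventually.of_forall fun y => ?_)
    · exact (by fun_prop : Measurable fun y : ℝ × ℝ =>
        η y.1 * (ε / ((y.1 - y.2) ^ 2 + ε ^ 2))).aestronglyMeasurable
    · rw [norm_mul]
      gcongr
      rw [Real.norm_of_nonneg (by positivity), div_le_div_iff₀ (by positivity) hε]
      nlinarith [sq_nonneg (y.1 - y.2)]
  have hI2 : Integrable (fun y : ℝ × ℝ => η (y.2 + ε * y.1) * (1 + y.1 ^ 2)⁻¹)
      (volume.prod μ) := by
    have hb : Integrable (fun y : ℝ × ℝ => (1 + y.1 ^ 2)⁻¹ * C) (volume.prod μ) :=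
      Integrable.mul_prod (f := fun x : ℝ => (1 + x ^ 2)⁻¹) (g := fun _ => C)
        integrable_inv_one_add_sq (integrable_const _)
    refine hb.mono' ?_ (Filter.Eventually.of_forall fun y => ?_)
    · exact (by fun_prop : Measurable fun y : ℝ × ℝ =>
        η (y.2 + ε * y.1) * (1 + y.1 ^ 2)⁻¹).aestronglyMeasurable
    · rw [norm_mul, mul_comm, Real.norm_of_nonneg (by positivity)]
      exact mul_le_mul_of_nonneg_left (hC _) (by positivity)
  simp_rw [← integral_const_mul]
  rw [integral_integral_swap hI1, integral_prod_symm _ hI2]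
  simp_rw [integral_mul_poisson_eq η _ hε]

theorem tendsto_integral_poisson (μ : Measure ℝ) [IsFiniteMeasure μ] {η : ℝ → ℝ}
    (hη : Continuous η) (hs : HasCompactSupport η) {ε : ℕ → ℝ}
    (hε : Filter.Tendsto ε Filter.atTop (𝓝 0)) :
    Filter.Tendsto
      (fun n => ∫ y : ℝ × ℝ, η (y.2 + ε n * y.1) * (1 + y.1 ^ 2)⁻¹ ∂(volume.prod μ))
      Filter.atTop (𝓝 (Real.pi * ∫ t, η t ∂μ)) := by
  obtain ⟨C, hC⟩ := hη.bounded_above_of_compact_support hs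
  have hlim : Real.pi * ∫ t, η t ∂μ
      = ∫ y : ℝ × ℝ, (1 + y.1 ^ 2)⁻¹ * η y.2 ∂(volume.prod μ) := by
    rw [integral_prod_mul (fun s : ℝ => (1 + s ^ 2)⁻¹) η, integral_univ_inv_one_add_sq]
  rw [hlim]
  refine tendsto_integral_of_dominated_convergence (fun y : ℝ × ℝ => (1 + y.1 ^ 2)⁻¹ * C)
    (fun n => ?_) ?_ (fun n => Filter.Eventually.of_forall fun y => ?_)
    (Filter.Eventually.of_forall fun y => ?_)
  · exact (by fun_prop : Measurable fun y : ℝ × ℝ =>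
      η (y.2 + ε n * y.1) * (1 + y.1 ^ 2)⁻¹).aestronglyMeasurable
  · exact Integrable.mul_prod (f := fun x : ℝ => (1 + x ^ 2)⁻¹) (g := fun _ => C)
      integrable_inv_one_add_sq (integrable_const _)
  · rw [norm_mul, mul_comm, Real.norm_of_nonneg (by positivity)]
    exact mul_le_mul_of_nonneg_left (hC _) (by positivity)
  · rw [mul_comm]
    refine Filter.Tendsto.mul_const _ ?_
    have : Filter.Tendsto (fun n => y.2 + ε n * y.1) Filter.atTop (𝓝 (y.2 + 0 * y.1)) :=
      tendsto_const_nhds.add (hε.mul_const _)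
    rw [zero_mul, add_zero] at this
    exact (hη.tendsto _).comp this

theorem integral_eq_of_stieltjesTransform (μ : Measure ℝ) [IsFiniteMeasure μ] {U : Set ℝ}
    {F : ℂ → ℂ} (hF : ContinuousOn F {z : ℂ | 0 ≤ z.im ∧ (z.im = 0 → z.re ∈ U)})
    (hμ : ∀ z : ℂ, 0 < z.im → stieltjesTransform μ z = F z) {η : ℝ → ℝ}
    (hη : Continuous η) (hs : HasCompactSupport η) (hU : tsupport η ⊆ U) :
    ∫ t, η t ∂μ = ∫ x, η x * (-(F x).im / Real.pi) := by
  set ε : ℕ → ℝ := fun n => 1 / ((n : ℝ) + 1) with hεdef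
  have hε0 : ∀ n, 0 < ε n := fun n => Nat.one_div_pos_of_nat
  have hε1 : ∀ n, ε n ≤ 1 := fun n => by
    rw [hεdef]
    refine (div_le_one (by positivity)).2 ?_
    have : (0 : ℝ) ≤ n := Nat.cast_nonneg n
    linarith
  have hε : Filter.Tendsto ε Filter.atTop (𝓝 0) := tendsto_one_div_add_atTop_nhds_zero_nat
  have h1 := tendsto_integral_poisson μ hη hs hε
  have h2 : ∀ n, ∫ y : ℝ × ℝ, η (y.2 + ε n * y.1) * (1 + y.1 ^ 2)⁻¹ ∂(volume.prod μ)
      = ∫ x : ℝ, η x * -(F ((x : ℂ) + ε n * Complex.I)).im := fun n => by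
    rw [← integral_integral_poisson_eq μ hη hs (hε0 n)]
    congr 1
    ext x
    rw [← neg_im_stieltjesTransform μ x (hε0 n), hμ _ (by simpa using hε0 n)]
  simp_rw [h2] at h1
  -- All points `x + i ε_n` with `x` in the support lie in this compact set, where `F` is bounded;
  -- this gives the dominating function.
  set K : Set ℂ := (fun y : ℝ × ℝ => (y.1 : ℂ) + y.2 * Complex.I) '' (tsupport η ×ˢ Icc 0 1)
    with hK
  have hKc : IsCompact K := (IsCompact.prod hs isCompact_Icc).image (by fun_prop)
  have hKD : K ⊆ {z : ℂ | 0 ≤ z.im ∧ (z.im = 0 → z.re ∈ U)} := by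
    rintro _ ⟨⟨x, y⟩, ⟨hx, hy⟩, rfl⟩
    simpa using ⟨hy.1, fun _ => hU hx⟩
  obtain ⟨C, hC⟩ := hKc.exists_bound_of_continuousOn (hF.mono hKD)
  have h3 : Filter.Tendsto (fun n => ∫ x : ℝ, η x * -(F ((x : ℂ) + ε n * Complex.I)).im)
      Filter.atTop (𝓝 (∫ x : ℝ, η x * -(F x).im)) := by
    refine tendsto_integral_of_dominated_convergence (fun x => ‖η x‖ * C) (fun n => ?_)
      ((hη.integrable_of_hasCompactSupport hs).norm.mul_const _)
      (fun n => Filter.Eventually.of_forall fun x => ?_)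
      (Filter.Eventually.of_forall fun x => ?_)
    · have hc : Continuous fun x : ℝ => F ((x : ℂ) + ε n * Complex.I) := by
        rw [← continuousOn_univ]
        refine hF.comp (by fun_prop) fun x _ => ?_
        have := hε0 n
        simp [this.le, this.ne']
      exact (hη.mul (Complex.continuous_im.comp hc).neg).aestronglyMeasurable
    · rw [norm_mul, norm_neg]
      by_cases hx : x ∈ tsupport η
      · refine mul_le_mul_of_nonneg_left ?_ (norm_nonneg _)
        exact (Complex.abs_im_le_norm _).trans (hC _ ⟨(x, ε n), ⟨hx, (hε0 n).le, hε1 n⟩, rfl⟩)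
      · simp [image_eq_zero_of_notMem_tsupport hx]
    · by_cases hx : x ∈ tsupport η
      · refine Filter.Tendsto.const_mul _ (Filter.Tendsto.neg ?_)
        refine (Complex.continuous_im.tendsto _).comp ?_
        have hmem : (x : ℂ) ∈ {z : ℂ | 0 ≤ z.im ∧ (z.im = 0 → z.re ∈ U)} := by
          simpa using hU hx
        refine (hF _ hmem).tendsto.comp (tendsto_nhdsWithin_iff.2 ⟨?_, ?_⟩)
        · have : Filter.Tendsto (fun n => (x : ℂ) + ε n * Complex.I) Filter.atTop
              (𝓝 ((x : ℂ) + ((0 : ℝ) : ℂ) * Complex.I)) :=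
            tendsto_const_nhds.add (((Complex.continuous_ofReal.tendsto _).comp hε).mul_const _)
          simpa using this
        · refine Filter.Eventually.of_forall fun n => ?_
          have := hε0 n
          simp [this.le, this.ne']
      · simp [image_eq_zero_of_notMem_tsupport hx]
  have h4 := tendsto_nhds_unique h1 h3
  have h5 : ∫ x, η x * (-(F x).im / Real.pi) = (∫ x : ℝ, η x * -(F x).im) / Real.pi := by
    rw [← integral_div]
    congr 1
    ext x
    ring
  rw [h5, ← h4, mul_div_cancel_left₀ _ Real.pi_ne_zero]

/-- The density need not be known integrable on `U`, so both measures are first multiplied by a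
cutoff `η` equal to 1 on a small ball; the resulting finite measures agree. Countably many balls
cover `U`. -/
theorem restrict_eq_of_integral_eq (μ : Measure ℝ) [IsFiniteMeasure μ] {U : Set ℝ}
    (hUo : IsOpen U) {ρ : ℝ → ℝ} (hρc : ContinuousOn ρ U) (hρ0 : ∀ x ∈ U, 0 ≤ ρ x)
    (h : ∀ η : ℝ → ℝ, Continuous η → HasCompactSupport η → tsupport η ⊆ U →
      ∫ t, η t ∂μ = ∫ x, η x * ρ x) :
    μ.restrict U = (volume.withDensity fun x => ENNReal.ofReal (ρ x)).restrict U := by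
  have hloc : ∀ x ∈ U, ∃ V : Set ℝ, IsOpen V ∧ x ∈ V ∧ V ⊆ U ∧
      μ.restrict V = (volume.withDensity fun x => ENNReal.ofReal (ρ x)).restrict V := by
    intro x hx
    obtain ⟨r, hr, hrU⟩ := Metric.nhds_basis_closedBall.mem_iff.1 (hUo.mem_nhds hx)
    obtain ⟨η, hη1, hηs, hηc, hη01⟩ := exists_continuousMap_one_of_isCompact_subset_isOpen
      (isCompact_closedBall x r) hUo hrU
    have hη0 : ∀ y, 0 ≤ η y := fun y => (hη01 y).1
    have hprod : ∀ f : ℝ → ℝ, (∀ y ∈ U, ContinuousAt f y) → Continuous fun y => η y * f y := by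
      intro f hf
      refine continuous_of_tsupport fun y hy => ?_
      exact η.continuous.continuousAt.mul (hf y (hηc (tsupport_mul_subset_left hy)))
    have hkc : Continuous fun y => η y * ρ y := hprod ρ fun y hy =>
      hρc.continuousAt (hUo.mem_nhds hy)
    have hk0 : ∀ y, 0 ≤ η y * ρ y := fun y => by
      by_cases hy : y ∈ U
      · exact mul_nonneg (hη0 y) (hρ0 y hy)
      · rw [image_eq_zero_of_notMem_tsupport fun h => hy (hηc h), zero_mul]
    have hηI : Integrable η μ := η.continuous.integrable_of_hasCompactSupport hηs
    have hkI : Integrable (fun y => η y * ρ y) := hkc.integrable_of_hasCompactSupport (HasCompactSupport.mul_right hηs)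
    have : IsFiniteMeasure (μ.withDensity fun y => ENNReal.ofReal (η y)) :=
      isFiniteMeasure_withDensity_ofReal hηI.2
    have : IsFiniteMeasure (volume.withDensity fun y => ENNReal.ofReal (η y * ρ y)) :=
      isFiniteMeasure_withDensity_ofReal hkI.2
    have heq : (μ.withDensity fun y => ENNReal.ofReal (η y))
        = volume.withDensity fun y => ENNReal.ofReal (η y * ρ y) := by
      refine ext_of_forall_integral_eq_of_IsFiniteMeasure fun f => ?_
      rw [integral_withDensity_eq_integral_toReal_smul η.continuous.measurable.ennreal_ofReal
          (Filter.Eventually.of_forall fun _ => ENNReal.ofReal_lt_top),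
        integral_withDensity_eq_integral_toReal_smul hkc.measurable.ennreal_ofReal
          (Filter.Eventually.of_forall fun _ => ENNReal.ofReal_lt_top)]
      simp only [ENNReal.toReal_ofReal (hη0 _), ENNReal.toReal_ofReal (hk0 _), smul_eq_mul]
      rw [h (fun y => η y * f y) (η.continuous.mul f.continuous) (HasCompactSupport.mul_right hηs)
        (tsupport_mul_subset_left.trans hηc)]
      congr 1
      ext y
      ring
    refine ⟨Metric.ball x r, Metric.isOpen_ball, Metric.mem_ball_self hr,
      Metric.ball_subset_closedBall.trans hrU, ?_⟩
    ext A hA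
    rw [Measure.restrict_apply hA, Measure.restrict_apply hA]
    have hm : MeasurableSet (A ∩ Metric.ball x r) := hA.inter measurableSet_ball
    have hone : ∀ y ∈ A ∩ Metric.ball x r, η y = 1 := fun y hy =>
      hη1 (Metric.ball_subset_closedBall hy.2)
    have := congrArg (fun m => m (A ∩ Metric.ball x r)) heq
    simp only [withDensity_apply _ hm] at this
    rw [withDensity_apply _ hm]
    rw [setLIntegral_congr_fun (μ := μ) (f := fun y => ENNReal.ofReal (η y)) (g := fun _ => 1) hm
        (fun y hy => by simp only [hone y hy, ENNReal.ofReal_one]),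
      setLIntegral_congr_fun (μ := volume) (f := fun y => ENNReal.ofReal (η y * ρ y))
        (g := fun y => ENNReal.ofReal (ρ y)) hm
        (fun y hy => by simp only [hone y hy, one_mul])] at this
    rw [← this, setLIntegral_one]
  choose! V hVo hxV hVU hV using hloc
  obtain ⟨T, hTc, hT⟩ := TopologicalSpace.isOpen_iUnion_countable (fun x : U => V x)
    fun x => hVo x x.2
  have hUV : U = ⋃ i ∈ T, V i := by
    rw [hT]
    refine Subset.antisymm (fun x hx => mem_iUnion.2 ⟨⟨x, hx⟩, hxV x hx⟩)
      (iUnion_subset fun x => hVU x x.2)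
  rw [hUV]
  exact (Measure.restrict_biUnion_congr hTc).2 fun i _ => hV i i.2

/-- Stieltjes inversion: if the Stieltjes transform extends continuously to a conull open subset
of the real line, its boundary values give the density of the absolutely continuous part. -/
theorem rnDeriv_eq_of_stieltjesTransform (μ : Measure ℝ) [IsFiniteMeasure μ] {U : Set ℝ}
    (hUo : IsOpen U) (hU0 : volume Uᶜ = 0) {F : ℂ → ℂ}
    (hF : ContinuousOn F {z : ℂ | 0 ≤ z.im ∧ (z.im = 0 → z.re ∈ U)})
    (hμ : ∀ z : ℂ, 0 < z.im → stieltjesTransform μ z = F z) {ρ : ℝ → ℝ}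
    (hρm : Measurable ρ) (hρ0 : ∀ x, 0 ≤ ρ x) (hρ : ∀ x ∈ U, ρ x = -(F x).im / Real.pi) :
    μ.rnDeriv volume =ᵐ[volume] fun x => ENNReal.ofReal (ρ x) := by
  have hFc : ContinuousOn (fun x : ℝ => -(F x).im / Real.pi) U := by
    have : ContinuousOn (fun x : ℝ => F x) U :=
      hF.comp Complex.continuous_ofReal.continuousOn fun x hx => by simpa using hx
    exact ((Complex.continuous_im.comp_continuousOn this).neg).div_const _
  have hr := restrict_eq_of_integral_eq μ hUo (hFc.congr hρ) (fun x _ => hρ0 x)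
    fun η hη hs hsU => by
      rw [integral_eq_of_stieltjesTransform μ hF hμ hη hs hsU]
      congr 1
      ext x
      by_cases hx : x ∈ tsupport η
      · rw [hρ x (hsU hx)]
      · simp [image_eq_zero_of_notMem_tsupport hx]
  have hac : (volume.withDensity fun x => ENNReal.ofReal (ρ x)).restrict U
      = volume.withDensity fun x => ENNReal.ofReal (ρ x) := by
    rw [restrict_withDensity hUo.measurableSet, Measure.restrict_eq_self_of_ae_mem]
    exact ae_iff.2 hU0
  -- As `Uᶜ` is null, `μ.restrict Uᶜ` is singular, and uniqueness of the Lebesgue decomposition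
  -- applies.
  refine (Measure.eq_rnDeriv (s := μ.restrict Uᶜ) hρm.ennreal_ofReal ?_ ?_).symm
  · refine ⟨U, hUo.measurableSet, ?_, hU0⟩
    rw [Measure.restrict_apply hUo.measurableSet, inter_compl_self, measure_empty]
  · rw [← hac, ← hr, add_comm, Measure.restrict_add_restrict_compl hUo.measurableSet]

end StieltjesInversion

/-! ### The explicit density and the explicit resolvent vector. -/

section AsymmetricFreeMeixner

/-- Inside the interval the right side is `|asymDen|²`, the root being `i √(4p - (x - q)²)` there.
-/
theorem four_mul_densityDen (p₀ p₁ p q₀ q x : ℝ) :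
    4 * p * densityDen p₀ p₁ p q₀ q x =
      ((2 * p - p₁) * (x - q₀) * (x - q) - 2 * p₀ * p) ^ 2
        + (p₁ * (x - q₀)) ^ 2 * (4 * p - (x - q) ^ 2) := by
  rw [densityDen]
  ring

theorem sq_lt_of_mem_Ioo {p q x : ℝ} (hp : 0 < p)
    (hx : x ∈ Ioo (q - 2 * √p) (q + 2 * √p)) : (x - q) ^ 2 < 4 * p := by
  have h4 : (2 * √p) ^ 2 = 4 * p := by rw [mul_pow, Real.sq_sqrt hp.le]; norm_num
  rw [← h4]
  exact sq_lt_sq' (by linarith [hx.1]) (by linarith [hx.2])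

theorem le_sq_of_notMem_Ioo {p q x : ℝ} (hp : 0 < p)
    (hx : x ∉ Ioo (q - 2 * √p) (q + 2 * √p)) : 4 * p ≤ (x - q) ^ 2 := by
  by_contra! h
  have h4 : (2 * √p) ^ 2 = 4 * p := by rw [mul_pow, Real.sq_sqrt hp.le]; norm_num
  have := abs_lt.1 (abs_lt_of_sq_lt_sq (h4.symm ▸ h) (by positivity))
  exact hx ⟨by linarith [this.1], by linarith [this.2]⟩

variable {p₀ p₁ p : ℝ} (q₀ q : ℝ)

theorem densityDen_pos (hp₀ : 0 < p₀) (hp₁ : 0 < p₁) (hp : 0 < p) {x : ℝ}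
    (hx : x ∈ Ioo (q - 2 * √p) (q + 2 * √p)) : 0 < densityDen p₀ p₁ p q₀ q x := by
  have h := sq_lt_of_mem_Ioo hp hx
  refine pos_of_mul_pos_right (?_ : 0 < 4 * p * densityDen p₀ p₁ p q₀ q x) (by positivity)
  rw [four_mul_densityDen]
  -- The second square vanishes only at `x = q₀`, where the first equals `(2 p₀ p)²`.
  by_cases ha : x - q₀ = 0
  · rw [ha]
    have : 0 < p₀ * p := mul_pos hp₀ hp
    ring_nf
    positivity
  · have h1 : 0 < (p₁ * (x - q₀)) ^ 2 := by positivity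
    have h2 : 0 < 4 * p - (x - q) ^ 2 := by linarith
    positivity

/-- Multiplying `asymDen` by its conjugate under `√ ↦ -√` gives `4p` times `densityDen`. -/
theorem densityDen_eq_zero_of_asymDen_eq_zero (hp : 0 < p) {x : ℝ}
    (h : asymDen p₀ p₁ p q₀ q x = 0) : densityDen p₀ p₁ p q₀ q x = 0 := by
  have hsq := sqrtBranch_sq hp.le ((x : ℂ) - q)
  rw [asymDen] at h
  have h1 : ((4 * p * densityDen p₀ p₁ p q₀ q x : ℝ) : ℂ) = 0 := by
    rw [four_mul_densityDen]
    push_cast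
    linear_combination ((2 * p - p₁) * (x - q₀) * (x - q) - 2 * p₀ * p
      - p₁ * (x - q₀) * sqrtBranch p ((x : ℂ) - q)) * h + (p₁ * (x - q₀) : ℂ) ^ 2 * hsq
  have h2 : 4 * p * densityDen p₀ p₁ p q₀ q x = 0 := by exact_mod_cast h1
  exact (mul_eq_zero.1 h2).resolve_left (by positivity)

theorem finite_densityDen_eq_zero (hp₀ : 0 < p₀) (hp : 0 < p) :
    {x : ℝ | densityDen p₀ p₁ p q₀ q x = 0}.Finite := by
  set P : Polynomial ℝ := Polynomial.C (p - p₁) * (Polynomial.X - Polynomial.C q₀) ^ 2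
      * (Polynomial.X - Polynomial.C q) ^ 2
    + (Polynomial.C (p₀ * (p₁ - 2 * p)) * (Polynomial.X - Polynomial.C q)
      + Polynomial.C (p₁ ^ 2) * (Polynomial.X - Polynomial.C q₀))
      * (Polynomial.X - Polynomial.C q₀) + Polynomial.C (p₀ ^ 2 * p) with hP
  have heval : ∀ x, P.eval x = densityDen p₀ p₁ p q₀ q x := fun x => by
    simp [hP, densityDen]
  -- The value at `q₀` is `p₀² p`.
  have hP0 : P ≠ 0 := by
    intro h0
    have h1 := heval q₀
    rw [h0, densityDen] at h1
    have : 0 < p₀ ^ 2 * p := by positivity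
    simp at h1
    rcases h1 with h1 | h1
    · exact hp₀.ne' h1
    · exact hp.ne' h1
  refine (Polynomial.finite_setOfPred_isRoot hP0).subset fun x hx => ?_
  exact (heval x).trans hx

theorem asymDensity_nonneg (hp₀ : 0 < p₀) (hp₁ : 0 < p₁) (hp : 0 < p) (x : ℝ) :
    0 ≤ asymDensity p₀ p₁ p q₀ q x := by
  refine indicator_nonneg (fun y hy => ?_) x
  have := densityDen_pos q₀ q hp₀ hp₁ hp hy
  have := Real.pi_pos
  positivity

theorem measurable_asymDensity : Measurable (asymDensity p₀ p₁ p q₀ q) := by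
  refine Measurable.indicator ?_ measurableSet_Ioo
  unfold densityDen
  fun_prop

/-- Off the interval the root is real, hence so is the quotient, even at a zero of the denominator
since division by zero gives 0. -/
theorem asymDensity_eq (hp₀ : 0 < p₀) (hp₁ : 0 < p₁) (hp : 0 < p) (x : ℝ) :
    asymDensity p₀ p₁ p q₀ q x =
      -(asymNum p₁ p q x / asymDen p₀ p₁ p q₀ q x).im / Real.pi := by
  have hcast : (x : ℂ) - q = ((x - q : ℝ) : ℂ) := by push_cast; rfl
  by_cases hx : x ∈ Ioo (q - 2 * √p) (q + 2 * √p)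
  · have hlt := sq_lt_of_mem_Ioo hp hx
    have hr : (√(4 * p - (x - q) ^ 2)) ^ 2 = 4 * p - (x - q) ^ 2 :=
      Real.sq_sqrt (by linarith)
    have hS : sqrtBranch p ((x : ℂ) - q) = (√(4 * p - (x - q) ^ 2) : ℝ) * Complex.I := by
      rw [hcast, sqrtBranch_ofReal_of_sq_lt hp.le hlt]
    have hd := densityDen_pos q₀ q hp₀ hp₁ hp hx
    rw [asymDensity, indicator_of_mem hx]
    set r := √(4 * p - (x - q) ^ 2)
    have hN : asymNum p₁ p q x
        = (((2 * p - p₁) * (x - q) : ℝ) : ℂ) + ((p₁ * r : ℝ) : ℂ) * Complex.I := by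
      rw [asymNum, hS]; push_cast; ring
    have hD : asymDen p₀ p₁ p q₀ q x
        = (((2 * p - p₁) * (x - q₀) * (x - q) - 2 * p₀ * p : ℝ) : ℂ)
          + ((p₁ * (x - q₀) * r : ℝ) : ℂ) * Complex.I := by
      rw [asymDen, hS]; push_cast; ring
    have hnorm : Complex.normSq (asymDen p₀ p₁ p q₀ q x)
        = 4 * p * densityDen p₀ p₁ p q₀ q x := by
      rw [hD, Complex.normSq_add_mul_I, four_mul_densityDen, mul_pow, hr]
    rw [Complex.div_im, hnorm, hN, hD]
    simp only [Complex.add_re, Complex.add_im, Complex.ofReal_re, Complex.ofReal_im,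
      Complex.re_ofReal_mul, Complex.im_ofReal_mul, Complex.I_re, Complex.I_im]
    field_simp
    ring
  · have hS : (sqrtBranch p ((x : ℂ) - q)).im = 0 := by
      rw [hcast, sqrtBranch_ofReal_im_of_le_sq hp.le (le_sq_of_notMem_Ioo hp hx)]
    have hS' : sqrtBranch p ((x : ℂ) - q) = ((sqrtBranch p ((x : ℂ) - q)).re : ℂ) :=
      Complex.ext rfl hS
    have hreal : ∃ y : ℝ, asymNum p₁ p q x / asymDen p₀ p₁ p q₀ q x = y := by
      rw [asymNum, asymDen, hS']
      generalize (sqrtBranch p ((x : ℂ) - q)).re = s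
      exact ⟨((2 * p - p₁) * x - q * (2 * p - p₁) + p₁ * s)
        / ((2 * p - p₁) * (x - q₀) * (x - q) - 2 * p₀ * p + p₁ * (x - q₀) * s), by push_cast; rfl⟩
    obtain ⟨y, hy⟩ := hreal
    rw [asymDensity, indicator_of_notMem hx, hy]
    simp

theorem continuousOn_asymNum : ContinuousOn (asymNum p₁ p q) {z | 0 ≤ z.im} := by
  have h : ContinuousOn (fun z : ℂ => sqrtBranch p (z - q)) {z | 0 ≤ z.im} :=
    (continuousOn_sqrtBranch p).comp (by fun_prop) fun z hz => by simpa using hz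
  unfold asymNum
  fun_prop

theorem continuousOn_asymDen : ContinuousOn (asymDen p₀ p₁ p q₀ q) {z | 0 ≤ z.im} := by
  have h := continuousOn_asymNum (p₁ := p₁) (p := p) q
  refine ContinuousOn.congr (f := fun z => (z - q₀) * asymNum p₁ p q z - 2 * p₀ * p)
    (by fun_prop) fun z _ => asymDen_eq p₀ p₁ p q₀ q z

theorem rnDeriv_eq_asymDensity (hp₀ : 0 < p₀) (hp₁ : 0 < p₁) (hp : 0 < p) (μ : Measure ℝ)
    [IsFiniteMeasure μ]
    (hμ : ∀ z : ℂ, z.im ≠ 0 →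
      stieltjesTransform μ z = asymNum p₁ p q z / asymDen p₀ p₁ p q₀ q z) :
    μ.rnDeriv volume =ᵐ[volume] fun x => ENNReal.ofReal (asymDensity p₀ p₁ p q₀ q x) := by
  have hc : Continuous fun x : ℝ => asymDen p₀ p₁ p q₀ q x := by
    rw [← continuousOn_univ]
    exact (continuousOn_asymDen q₀ q).comp Complex.continuous_ofReal.continuousOn
      fun x _ => by simp
  refine rnDeriv_eq_of_stieltjesTransform μ (U := {x : ℝ | asymDen p₀ p₁ p q₀ q x ≠ 0})
    (F := fun z => asymNum p₁ p q z / asymDen p₀ p₁ p q₀ q z)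
    (isOpen_ne_fun hc continuous_const) ?_ ?_ (fun z hz => hμ z hz.ne')
    (measurable_asymDensity q₀ q) (asymDensity_nonneg q₀ q hp₀ hp₁ hp)
    (fun x _ => asymDensity_eq q₀ q hp₀ hp₁ hp x)
  · refine measure_mono_null (fun x hx => ?_)
      ((finite_densityDen_eq_zero (p₁ := p₁) q₀ q hp₀ hp).measure_zero volume)
    exact densityDen_eq_zero_of_asymDen_eq_zero q₀ q hp (not_not.1 hx)
  · refine ((continuousOn_asymNum q).mono fun z hz => hz.1).div
      ((continuousOn_asymDen q₀ q).mono fun z hz => hz.1) fun z hz => ?_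
    by_cases h0 : z.im = 0
    · have hz2 := hz.2 h0
      have : (z.re : ℂ) = z := Complex.ext rfl (by simp [h0])
      rwa [mem_ofPred_eq, this] at hz2
    · exact asymDen_ne_zero q₀ q hp₀ hp₁ hp h0

theorem exists_resolvent_vector (hp₀ : 0 < p₀) (hp₁ : 0 < p₁) (hp : 0 < p) {z : ℂ}
    (hz : z.im ≠ 0) : ∃ u : SqSum, z • u - jacobiOp √p₀ √p₁ √p q₀ q u = stdVec 0 ∧
      (⟪stdVec 0, u⟫ : ℂ) = asymNum p₁ p q z / asymDen p₀ p₁ p q₀ q z := by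
  have hw : (z - q).im ≠ 0 := by simpa using hz
  obtain ⟨ht0, ht1, hwt, -⟩ := decayRoot_spec hp hw
  have hD := asymDen_ne_zero q₀ q hp₀ hp₁ hp hz
  rw [asymDen_eq, asymNum_eq hp] at hD
  rw [asymDen_eq, asymNum_eq hp]
  set t := decayRoot p (z - q) with ht
  obtain ⟨v, hv0, hv1, hv⟩ := exists_jacobiOp_tail √p₀ √p₁ √p q₀ q (t := t) (z := z) ht1 ht0
    (by rw [← hwt]; ring)
  have hsC : ((√p : ℝ) : ℂ) ≠ 0 := Complex.ofReal_ne_zero.2 (Real.sqrt_pos.2 hp).ne'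
  have hpC : (p : ℂ) ≠ 0 := Complex.ofReal_ne_zero.2 hp.ne'
  have h0 : ((√p₀ : ℝ) : ℂ) ^ 2 = p₀ := by rw [← Complex.ofReal_pow, Real.sq_sqrt hp₀.le]
  have h1 : ((√p₁ : ℝ) : ℂ) ^ 2 = p₁ := by rw [← Complex.ofReal_pow, Real.sq_sqrt hp₁.le]
  set K : ℂ := z - q - p₁ * (t / (√p : ℝ)) with hK
  set E : ℂ := (z - q₀) * K - p₀ with hE
  have hDE : (z - q₀) * (2 * p * K) - 2 * p₀ * p = 2 * p * E := by rw [hE]; ring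
  rw [hDE] at hD ⊢
  have hE0 : E ≠ 0 := right_ne_zero_of_mul hD
  -- For `u = c₀ e₀ + c₁ e₁ + c₂ v`, the `e₂` row gives `c₂ = c₁ √p₁ t / √p`, the `e₁` row `c₁ K =
  -- c₀ √p₀`, and the `e₀` row fixes the scale `1 / E`.
  refine ⟨(K / E) • stdVec 0 + (√p₀ / E) • stdVec 1 + (√p₀ / E * √p₁ * t / √p) • v, ?_, ?_⟩
  · simp only [map_add, map_smul, jacobiOp_stdVec_zero, jacobiOp_stdVec_one, hv]
    have e0 : K / E * (z - q₀) - √p₀ / E * √p₀ = 1 := by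
      field_simp
      rw [h0, hE]; ring
    have e1 : -(K / E * √p₀) + √p₀ / E * (z - q) - √p₀ / E * √p₁ * t / √p * √p₁ = 0 := by
      rw [hK, ← h1]
      field_simp
      ring
    have e2 : -(√p₀ / E * √p₁) + √p₀ / E * √p₁ * t / √p * (√p / t) = 0 := by
      field_simp
      ring
    trans (K / E * (z - q₀) - √p₀ / E * √p₀) • stdVec 0
      + (-(K / E * √p₀) + √p₀ / E * (z - q) - √p₀ / E * √p₁ * t / √p * √p₁) • stdVec 1
      + (-(√p₀ / E * √p₁) + √p₀ / E * √p₁ * t / √p * (√p / t)) • stdVec 2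
    · module
    · rw [e0, e1, e2]
      module
  · simp only [inner_add_right, inner_smul_right, inner_stdVec, hv0]
    simp only [if_true, mul_one, mul_zero, add_zero, zero_ne_one, if_false]
    rw [mul_div_mul_left _ _ (mul_ne_zero two_ne_zero hpC)]

end AsymmetricFreeMeixner

theorem proposition5p3 (p₀ p₁ p q₀ q : ℝ) (hp₀ : 0 < p₀) (hp₁ : 0 < p₁) (hp : 0 < p) :
    ∃ μ : Measure ℝ, IsProbabilityMeasure μ ∧
      HasJacobiCoefficients μ (betaSeq q₀ q) (gammaSeq p₀ p₁ p) ∧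
      (∀ ν : Measure ℝ, IsProbabilityMeasure ν →
        HasJacobiCoefficients ν (betaSeq q₀ q) (gammaSeq p₀ p₁ p) → ν = μ) ∧
      (∀ z : ℂ, z.im ≠ 0 →
        asymDen p₀ p₁ p q₀ q z ≠ 0 ∧
        stieltjesTransform μ z = asymNum p₁ p q z / asymDen p₀ p₁ p q₀ q z) ∧
      (∀ x ∈ Ioo (q - 2 * Real.sqrt p) (q + 2 * Real.sqrt p), 0 < densityDen p₀ p₁ p q₀ q x) ∧
      μ.rnDeriv volume =ᵐ[volume] fun x => ENNReal.ofReal (asymDensity p₀ p₁ p q₀ q x) := by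
  have hT := isSelfAdjoint_jacobiOp √p₀ √p₁ √p q₀ q
  obtain ⟨μ, hfin, ⟨R, hR0, hR⟩, hμ⟩ := exists_spectralMeasure hT (stdVec 0)
  have hint : ∀ f : ℝ → ℝ, Continuous f → Integrable f μ := fun f hf =>
    integrable_of_continuous_of_measure_compl_Icc hR hf
  have hprob : IsProbabilityMeasure μ := by
    have h := measureReal_univ_of_spectralMeasure hT hμ
    rw [orthonormal_stdVec.1, one_pow] at h
    exact ⟨(ENNReal.toReal_eq_one_iff _).1 h⟩
  have hJ : HasJacobiCoefficients μ (betaSeq q₀ q) (gammaSeq p₀ p₁ p) := by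
    refine hasJacobiCoefficients_of_spectralMeasure hT orthonormal_stdVec
      (a := fun n => √(gammaSeq p₀ p₁ p n)) (jacobiOp_stdVec_zero _ _ _ _ _) ?_ ?_ ?_
      (fun n => hint _ (by fun_prop)) hμ
    · rintro (_ | _ | n)
      · exact jacobiOp_stdVec_one _ _ _ _ _
      · exact jacobiOp_stdVec_two _ _ _ _ _
      · exact jacobiOp_stdVec_add_three _ _ _ _ _ n
    · rintro (_ | _ | n)
      exacts [(Real.sq_sqrt hp₀.le).symm, (Real.sq_sqrt hp₁.le).symm, (Real.sq_sqrt hp.le).symm]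
    · rintro (_ | _ | n)
      exacts [Real.sqrt_pos.2 hp₀, Real.sqrt_pos.2 hp₁, Real.sqrt_pos.2 hp]
  have hS : ∀ z : ℂ, z.im ≠ 0 →
      stieltjesTransform μ z = asymNum p₁ p q z / asymDen p₀ p₁ p q₀ q z := by
    intro z hz
    obtain ⟨u, hu, hu'⟩ := exists_resolvent_vector q₀ q hp₀ hp₁ hp hz
    rw [stieltjesTransform_of_spectralMeasure hT hint hμ hz hu, hu']
  refine ⟨μ, hprob, hJ, fun ν hν hνJ => ?_,
    fun z hz => ⟨asymDen_ne_zero q₀ q hp₀ hp₁ hp hz, hS z hz⟩,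
    fun x hx => densityDen_pos q₀ q hp₀ hp₁ hp hx,
    rnDeriv_eq_asymDensity q₀ q hp₀ hp₁ hp μ hS⟩
  exact eq_of_integral_eval_eq hR0 hR hνJ.integrable_pow
    (integral_eval_eq_of_hasJacobiCoefficients hνJ hJ)
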